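/- Let $\mathscr{A}$ and $\mathscr{B}$ be abelian categories, both with enough projective objects and enough injective objects, and let $T:\mathscr{B}\to\mathscr{A}$ be a right exact (additive) functor. The comma category $(T\downarrow\mathscr{A})$ is the abelian category whose objects are triples $\binom{A}{B}_{\varphi}$ with $A\in\mathscr{A}$, $B\in\mathscr{B}$ and $\varphi:T(B)\to A$ a morphism in $\mathscr{A}$; a morphism $\binom{A}{B}_{\varphi}\to\binom{A'}{B'}_{\varphi'}$ is a pair $(a:A\to A',\ b:B\to B')$ with $\varphi' T(b)=a\varphi$. Let $\mathbf{p}:\mathscr{A}\times\mathscr{B}\to(T\downarrow\mathscr{A})$ be the functor $\mathbf{p}(A,B)=\binom{A\oplus T(B)}{B}$ with structure morphism the inclusion $T(B)\to A\oplus T(B)$, and $\mathbf{p}(a,b)=(a\oplus T(b),b)$. For a class $\mathcal{X}$ of objects of an abelian category $\mathscr{D}$ put $\mathcal{X}^{\perp}=\{M : \mathrm{Ext}^1_{\mathscr{D}}(X,M)=0 \text{ for all } X\in\mathcal{X}\}$. The class $\mathcal{X}$ is special precovering in $\mathscr{D}$ if for every object $M$ there is an epimorphism $f:G\to M$ with $G\in\mathcal{X}$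 and $\ker f\in\mathcal{X}^{\perp}$. It is closed under extensions if, for every short exact sequence $0\to D'\to D\to D''\to 0$ with $D',D''\in\mathcal{X}$, also $D\in\mathcal{X}$. For a class $\mathcal{Y}$ of objects of $\mathscr{B}$, the functor $T$ is $\mathcal{Y}$-exact if $0\to T(B)\to T(B')\to T(Y)\to 0$ is exact for every short exact sequence $0\to B\to B'\to Y\to 0$ in $\mathscr{B}$ with $Y\in\mathcal{Y}$. For classes $\mathcal{X}$ of objects of $\mathscr{A}$ and $\mathcal{Y}$ of objects of $\mathscr{B}$, let $\langle\mathbf{p}(\mathcal{X},\mathcal{Y})\rangle$ be the class of objects $E$ of $(T\downarrow\mathscr{A})$ for which there is an exact sequence $0\to\mathbf{p}(X',Y')\to E\to\mathbf{p}(X,Y)\to 0$ with $X,X'\in\mathcal{X}$ and $Y,Y'\in\mathcal{Y}$. A complete projective resolution in an abelian category $\mathscr{D}$ is an exact complex $P^\bullet=(\cdots\to P^{-1}\to P^0\to P^1\to\cdots)$ of projective objects such that $\mathrm{Hom}_{\mathscr{D}}(P^\bullet,P)$ is exact for every projective object $P$. An object is Gorenstein projective if it is isomorphic to $\ker(P^0\to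 P^1)$ for some complete projective resolution $P^\bullet$; $\mathcal{GP}_{\mathscr{D}}$ denotes the class of Gorenstein projective objects. The functor $T$ is compatible if (C1) $T(Q^\bullet)$ is exact for every exact complex $Q^\bullet$ (unbounded in both directions) of projective objects of $\mathscr{B}$, and (C2) $\mathrm{Hom}_{\mathscr{A}}(P^\bullet,T(Q))$ is exact for every complete projective resolution $P^\bullet$ in $\mathscr{A}$ and every projective object $Q$ of $\mathscr{B}$. Theorem. (1) Let $\mathcal{X}$ be a class of objects of $\mathscr{A}$ with $0\in\mathcal{X}$ and $\mathcal{Y}$ a class of objects of $\mathscr{B}$ with $0\in\mathcal{Y}$, and assume that $T$ is $\mathcal{Y}$-exact. If $\mathcal{X}$ and $\mathcal{Y}$ are special precovering in $\mathscr{A}$ and $\mathscr{B}$, respectively, then $\langle\mathbf{p}(\mathcal{X},\mathcal{Y})\rangle$ is special precovering in $(T\downarrow\mathscr{A})$. Conversely, if $T(\mathcal{Y}\cap\mathcal{Y}^{\perp})\subseteq\mathcal{X}^{\perp}$, $\mathcal{X}$ and $\mathcal{Y}$ are closed under extensions, and $\langle\mathbf{p}(\mathcal{X},\mathcal{Y})\rangle$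 is special precovering in $(T\downarrow\mathscr{A})$, then $\mathcal{X}$ and $\mathcal{Y}$ are special precovering in $\mathscr{A}$ and $\mathscr{B}$, respectively. (2) If $T$ is compatible, then $\mathcal{GP}_{\mathscr{A}}$ and $\mathcal{GP}_{\mathscr{B}}$ are special precovering in $\mathscr{A}$ and $\mathscr{B}$, respectively, if and only if $\mathcal{GP}_{(T\downarrow\mathscr{A})}$ is special precovering in $(T\downarrow\mathscr{A})$. -/

import Mathlib

open CategoryTheory CategoryTheory.Limits

universe v v₁ v₂ u u₁ u₂

namespace CommaPrecover

section AbelianCategory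

variable {C : Type u} [Category.{v} C] [Abelian C]

/-- The right orthogonal class `𝒳^⊥ = {M | Ext¹(G, M) = 0 for every G ∈ 𝒳}`. The group `Ext¹` is
Mathlib's Yoneda/derived `Ext`, taken in a universe where it exists in every abelian category. -/
def rightPerp (X : ObjectProperty C) : ObjectProperty C := fun M =>
  ∀ ⦃G : C⦄, X G →
    haveI : HasExt.{max u v} C := HasExt.standard C
    Subsingleton (Abelian.Ext.{max u v} G M 1)

/-- `f : G ⟶ M` is a special `𝒳`-precover of `M`. -/
structure IsSpecialPrecover (X : ObjectProperty C) {G M : C} (f : G ⟶ M) : Prop where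
  epi : Epi f
  mem : X G
  kernel_mem : rightPerp X (kernel f)

/-- The class `𝒳` is special precovering: every object has a special `𝒳`-precover. -/
def IsSpecialPrecovering (X : ObjectProperty C) : Prop :=
  ∀ M : C, ∃ (G : C) (f : G ⟶ M), IsSpecialPrecover X f

/-- The complex of abelian groups `Hom(K, N)`. -/
noncomputable def homComplex (K : CochainComplex C ℤ) (N : C) :
    HomologicalComplex AddCommGrpCat.{v} (ComplexShape.up ℤ).symm :=
  ((preadditiveYoneda.obj N).mapHomologicalComplex (ComplexShape.up ℤ).symm).obj
    (HomologicalComplex.op K)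

/-- An exact (unbounded) complex of projective objects. -/
structure IsExactProjectiveComplex (K : CochainComplex C ℤ) : Prop where
  exact : K.Acyclic
  projective : ∀ i : ℤ, Projective (K.X i)

/-- A complete projective resolution: an exact complex of projective objects which stays
exact under `Hom(-, P)` for every projective object `P`. -/
structure IsCompleteProjectiveResolution (K : CochainComplex C ℤ) : Prop
    extends IsExactProjectiveComplex K where
  hom_exact : ∀ P : C, Projective P → (homComplex K P).Acyclic

/-- The class of Gorenstein projective objects: those isomorphic to `Z⁰(K) = ker (K⁰ ⟶ K¹)` for
some complete projective resolution `K`. -/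
def gorensteinProjective (C : Type u) [Category.{v} C] [Abelian C] : ObjectProperty C := fun M =>
  ∃ K : CochainComplex C ℤ, IsCompleteProjectiveResolution K ∧ Nonempty (M ≅ kernel (K.d 0 1))

end AbelianCategory

section CommaCategory

variable {A : Type u₁} [Category.{v₁} A] [Abelian A]
variable {B : Type u₂} [Category.{v₂} B] [Abelian B]

/-- `T` is `𝒴`-exact: it keeps every short exact sequence `0 ⟶ B₁ ⟶ B₂ ⟶ Y ⟶ 0` with `Y ∈ 𝒴`
short exact. -/
def IsExactOn (T : B ⥤ A) [T.Additive] (Y : ObjectProperty B) : Prop :=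
  ∀ S : ShortComplex B, S.ShortExact → Y S.X₃ → (S.map T).ShortExact

/-- `T` is compatible. -/
structure IsCompatible (T : B ⥤ A) [T.Additive] : Prop where
  exact_map : ∀ Q : CochainComplex B ℤ, IsExactProjectiveComplex Q →
    ((T.mapHomologicalComplex (ComplexShape.up ℤ)).obj Q).Acyclic
  hom_exact : ∀ P : CochainComplex A ℤ, IsCompleteProjectiveResolution P →
    ∀ Q : B, Projective Q → (homComplex P (T.obj Q)).Acyclic

/-- The comma category `(T ↓ 𝒜)`: an object consists of `left : B`, `right : A` and
`hom : T(left) ⟶ right`. -/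
abbrev CommaCat (T : B ⥤ A) := Comma T (𝟭 A)

section abelian

variable (T : B ⥤ A)

instance preservesLimitsOfShape_fst (J : Type) [SmallCategory J] [FinCategory J] :
    PreservesLimitsOfShape J (Comma.fst T (𝟭 A)) where
  preservesLimit :=
    preservesLimit_of_preserves_limit_cone
      (Comma.coneOfPreservesIsLimit _ (limit.isLimit _) (limit.isLimit _))
      (limit.isLimit _)

instance preservesLimitsOfShape_snd (J : Type) [SmallCategory J] [FinCategory J] :
    PreservesLimitsOfShape J (Comma.snd T (𝟭 A)) where
  preservesLimit :=
    preservesLimit_of_preserves_limit_cone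
      (Comma.coneOfPreservesIsLimit _ (limit.isLimit _) (limit.isLimit _))
      (limit.isLimit _)

variable [T.Additive] [PreservesFiniteColimits T]

instance isIso_coimageImageComparison {U V : CommaCat T} (f : U ⟶ V) :
    IsIso (Abelian.coimageImageComparison f) := by
  have h₁ : IsIso ((Comma.fst T (𝟭 A)).map (Abelian.coimageImageComparison f)) :=
    Arrow.isIso_iff_isIso_of_isIso
      (Abelian.PreservesCoimageImageComparison.iso (Comma.fst T (𝟭 A)) f).hom |>.mpr
        (inferInstanceAs (IsIso (Abelian.coimageImageComparison ((Comma.fst T (𝟭 A)).map f))))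
  have h₂ : IsIso ((Comma.snd T (𝟭 A)).map (Abelian.coimageImageComparison f)) :=
    Arrow.isIso_iff_isIso_of_isIso
      (Abelian.PreservesCoimageImageComparison.iso (Comma.snd T (𝟭 A)) f).hom |>.mpr
        (inferInstanceAs (IsIso (Abelian.coimageImageComparison ((Comma.snd T (𝟭 A)).map f))))
  exact (Comma.isoMk (@asIso _ _ _ _ _ h₁) (@asIso _ _ _ _ _ h₂)
    (Abelian.coimageImageComparison f).w).isIso_hom

/-- The comma category of a right exact functor is abelian. -/
noncomputable instance commaAbelian : Abelian (CommaCat T) :=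
  Abelian.ofCoimageImageComparisonIsIso

end abelian

variable (T : B ⥤ A)

/-- The functor `𝐩 : 𝒜 × ℬ ⥤ (T ↓ 𝒜)`, sending `(M, N)` to `M ⊕ T(N)` over `N` with structure
morphism the inclusion of `T(N)`. -/
@[simps]
noncomputable def p : A × B ⥤ CommaCat T where
  obj M := { left := M.2, right := M.1 ⊞ T.obj M.2, hom := biprod.inr }
  map f := { left := f.2, right := biprod.map f.1 (T.map f.2) }

variable [T.Additive] [PreservesFiniteColimits T]

/-- The class `⟨𝐩(𝒳, 𝒴)⟩` of objects `E` in an exact sequence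
`0 ⟶ 𝐩(X', Y') ⟶ E ⟶ 𝐩(X, Y) ⟶ 0` with `X', X ∈ 𝒳` and `Y', Y ∈ 𝒴`. -/
def extP (X : ObjectProperty A) (Y : ObjectProperty B) : ObjectProperty (CommaCat T) := fun E =>
  ∃ (M' M : A) (N' N : B) (f : (p T).obj (M', N') ⟶ E) (g : E ⟶ (p T).obj (M, N))
    (w : f ≫ g = 0), X M' ∧ X M ∧ Y N' ∧ Y N ∧ (ShortComplex.mk f g w).ShortExact

end CommaCategory

end CommaPrecover

/-!
The proof works with `Ext¹` through short exact sequences only: `Ext¹(G, M) = 0` makes morphisms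
into `M` extend along monomorphisms with cokernel `G`, makes morphisms from `G` lift along
epimorphisms with kernel `M`, and, in the presence of enough projectives, follows from the splitting
of all extensions of `G` by `M`. The comma category has enough projectives, of the form `𝐩(P, Q)`,
and short exactness there is checked on components.

*Special precovers.* The functor `𝐩` is left adjoint to the forgetful functor to `𝒜 × ℬ`, so an
extension of `𝐩(M, N)` by `K` splits as soon as its two components split (`ext1Vanishes_p`).
Therefore `K` lies in `⟨𝐩(𝒳, 𝒴)⟩^⊥` when `K.right ∈ 𝒳^⊥` and `K.left ∈ 𝒴^⊥`. Given an object
`T(B) ⟶ A`, a special `𝒴`-precover `N ⟶ B` and an embedding of `T(N)` into `A ⊞ I` with `I`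
injective, let `P` be the middle term of the pullback of `0 ⟶ T(N) ⟶ A ⊞ I ⟶ C ⟶ 0` along a special
`𝒳`-precover of `C`: then `T(N) ⟶ P` is a special precover (`isSpecialPrecovering_extP`).
Conversely, `𝒴`-exactness makes the structure morphism of an object of `⟨𝐩(𝒳, 𝒴)⟩` a monomorphism
with cokernel in `𝒳`. A special precover of `(0, N)` gives one of `N`. In a special precover `E` of
`(M, 0)`, the object `E.left` lies in `𝒴 ∩ 𝒴^⊥`, hence `T(E.left) ⟶ E.right` splits, and its
cokernel is a special precover of `M` (`isSpecialPrecovering_right_of_extP`).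

*Gorenstein projective objects.* They form the largest class that is left orthogonal to the
projective objects and in which every object both is and has a syzygy
(`gorensteinProjective_of_class`); this replaces the manipulation of unbounded complexes by that of
short exact sequences. It shows that they are closed under extensions and, when `T` is compatible,
that `⟨𝐩(𝒢𝒫, 𝒢𝒫)⟩` is the class of Gorenstein projective objects of the comma category
(`extP_gorensteinProjective`). Condition (C1) makes the structure morphism of a Gorenstein
projective object a monomorphism; condition (C2) gives `Ext¹(G, T(Q)) = 0` for `G` Gorenstein
projective and `Q` projective. The second part of the theorem is then the first one applied to the
Gorenstein projective classes, as a Gorenstein projective object of `𝒢𝒫^⊥` is projective.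
-/

namespace CommaPrecover

open ZeroObject

/-! ### Short exact sequences -/

section ShortExact

variable {C : Type u} [Category.{v} C] [Abelian C]

lemma shortExact_kernel {X Y : C} (f : X ⟶ Y) [Epi f] :
    (ShortComplex.mk (kernel.ι f) f (kernel.condition f)).ShortExact :=
  .mk' (ShortComplex.exact_of_f_is_kernel _ (kernelIsKernel f)) inferInstance inferInstance

lemma shortExact_cokernel {X Y : C} (f : X ⟶ Y) [Mono f] :
    (ShortComplex.mk f (cokernel.π f) (cokernel.condition f)).ShortExact :=
  .mk' (ShortComplex.exact_of_g_is_cokernel _ (cokernelIsCokernel f)) inferInstance inferInstance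

lemma shortExact_biprod' (X Y : C) :
    (ShortComplex.mk (biprod.inr : Y ⟶ X ⊞ Y) biprod.fst (by simp)).ShortExact :=
  .mk' (ShortComplex.exact_of_f_is_kernel _ (BinaryBicone.isLimitFstKernelFork
    (BinaryBiproduct.isLimit X Y))) inferInstance inferInstance

lemma shortExact_biprod (X Y : C) :
    (ShortComplex.mk (biprod.inl : X ⟶ X ⊞ Y) biprod.snd (by simp)).ShortExact :=
  (ShortComplex.Splitting.ofHasBinaryBiproduct X Y).shortExact

/-- The kernel of the second map of a short exact sequence is its first term. -/
noncomputable def kernelIsoOfShortExact {S : ShortComplex C} (hS : S.ShortExact) :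
    kernel S.g ≅ S.X₁ :=
  (kernelIsKernel S.g).conePointUniqueUpToIso hS.fIsKernel

lemma shortExact_of_iso_right {X Y Z Z' : C} {f : X ⟶ Y} {g : Y ⟶ Z} {w : f ≫ g = 0}
    (h : (ShortComplex.mk f g w).ShortExact) (e : Z ≅ Z') (w' : f ≫ g ≫ e.hom = 0) :
    (ShortComplex.mk f (g ≫ e.hom) w').ShortExact :=
  ShortComplex.shortExact_of_iso (S₁ := ShortComplex.mk f g w)
    (ShortComplex.isoMk (Iso.refl _) (Iso.refl _) e (by simp) (by simp)) h

lemma shortExact_of_iso_left {X X' Y Z : C} {f : X ⟶ Y} {g : Y ⟶ Z} {w : f ≫ g = 0}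
    (h : (ShortComplex.mk f g w).ShortExact) (e : X' ≅ X) (w' : (e.hom ≫ f) ≫ g = 0) :
    (ShortComplex.mk (e.hom ≫ f) g w').ShortExact :=
  ShortComplex.shortExact_of_iso (S₁ := ShortComplex.mk f g w)
    (ShortComplex.isoMk e.symm (Iso.refl _) (Iso.refl _) (by simp) (by simp)) h

lemma shortExact_id_zero (X : C) {Z : C} (hZ : IsZero Z) :
    (ShortComplex.mk (𝟙 X) (0 : X ⟶ Z) comp_zero).ShortExact :=
  have : Epi (0 : X ⟶ Z) := ⟨fun _ _ _ => hZ.eq_of_src _ _⟩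
  .mk' ((ShortComplex.exact_iff_epi _ rfl).2 (inferInstanceAs (Epi (𝟙 X)))) inferInstance this

lemma shortExact_zero_id (X : C) {Z : C} (hZ : IsZero Z) :
    (ShortComplex.mk (0 : Z ⟶ X) (𝟙 X) zero_comp).ShortExact :=
  have : Mono (0 : Z ⟶ X) := ⟨fun _ _ _ => hZ.eq_of_tgt _ _⟩
  .mk' ((ShortComplex.exact_iff_mono _ rfl).2 (inferInstanceAs (Mono (𝟙 X)))) this inferInstance

/-- A class closed under extensions and containing zero is closed under isomorphisms. -/
lemma prop_of_iso_of_closedUnderExtensions {P : ObjectProperty C} (h₀ : P.ContainsZero)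
    (h : P.IsClosedUnderExtensions) {X Y : C} (e : X ≅ Y) (hY : P Y) : P X := by
  obtain ⟨Z, hZ, hPZ⟩ := h₀.exists_zero
  have := h.prop_X₂_of_shortExact
    (shortExact_of_iso_right (shortExact_zero_id X hZ) e (by simp)) hPZ hY
  exact this

/-- The pushout of a short exact sequence along a morphism from its first term. -/
lemma exists_pushout {S : ShortComplex C} (hS : S.ShortExact) {M : C} (f : S.X₁ ⟶ M) :
    ∃ (E : C) (i : M ⟶ E) (q : E ⟶ S.X₃) (w : i ≫ q = 0) (k : S.X₂ ⟶ E),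
      (ShortComplex.mk i q w).ShortExact ∧ IsPushout S.f f k i ∧ k ≫ q = S.g := by
  have := hS.mono_f
  have := hS.epi_g
  have hpo := IsPushout.of_hasPushout S.f f
  have hk : pushout.inl S.f f ≫ pushout.desc S.g (0 : M ⟶ S.X₃) (by simp) = S.g :=
    pushout.inl_desc _ _ _
  refine ⟨pushout S.f f, pushout.inr _ _, pushout.desc S.g 0 (by simp), pushout.inr_desc _ _ _,
    pushout.inl _ _, ?_, hpo, hk⟩
  have : Epi (pushout.desc S.g (0 : M ⟶ S.X₃) (by simp) : pushout S.f f ⟶ _) :=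
    epi_of_epi_fac hk
  refine .mk' (ShortComplex.exact_of_g_is_cokernel _ ?_) inferInstance inferInstance
  refine CokernelCofork.IsColimit.ofπ' _ _ fun {T} t ht => ?_
  have h0 : S.f ≫ pushout.inl S.f f ≫ t = 0 := by
    rw [pushout.condition_assoc]; simp [show pushout.inr S.f f ≫ t = 0 from ht]
  refine ⟨hS.gIsCokernel.desc (CokernelCofork.ofπ _ h0), ?_⟩
  apply pushout.hom_ext
  · have := hS.gIsCokernel.fac (CokernelCofork.ofπ _ h0) WalkingParallelPair.one
    rw [reassoc_of% hk]; simpa using this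
  · rw [pushout.inr_desc_assoc, zero_comp]; exact ht.symm

/-- The base change of a short exact sequence along a morphism into its last term. -/
lemma shortExact_of_isPullback {S : ShortComplex C} (hS : S.ShortExact) {M E : C} {f : M ⟶ S.X₃}
    {k : E ⟶ S.X₂} {q : E ⟶ M} (h : IsPullback k q S.g f) :
    ∃ (i : S.X₁ ⟶ E) (w : i ≫ q = 0), (ShortComplex.mk i q w).ShortExact ∧ i ≫ k = S.f := by
  have := hS.mono_f
  have := hS.epi_g
  have hk : h.lift S.f (0 : S.X₁ ⟶ M) (by simp) ≫ k = S.f := h.lift_fst _ _ _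
  have hq : h.lift S.f (0 : S.X₁ ⟶ M) (by simp) ≫ q = 0 := h.lift_snd _ _ _
  refine ⟨h.lift S.f 0 (by simp), hq, ?_, hk⟩
  have : Mono (h.lift S.f (0 : S.X₁ ⟶ M) (by simp)) := mono_of_mono_fac hk
  have : Epi q := MorphismProperty.of_isPullback (P := MorphismProperty.epimorphisms C) h
    (MorphismProperty.epimorphisms.infer_property S.g)
  refine .mk' (ShortComplex.exact_of_f_is_kernel _ ?_) inferInstance inferInstance
  refine KernelFork.IsLimit.ofι' _ _ fun {T} t ht => ?_
  have h0 : (t ≫ k) ≫ S.g = 0 := by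
    rw [Category.assoc, h.w, ← Category.assoc, show t ≫ q = 0 from ht, zero_comp]
  refine ⟨hS.fIsKernel.lift (KernelFork.ofι _ h0), ?_⟩
  apply h.hom_ext
  · have := hS.fIsKernel.fac (KernelFork.ofι _ h0) WalkingParallelPair.zero
    rw [Category.assoc, hk]; simpa using this
  · rw [Category.assoc, hq, comp_zero]; exact ht.symm

/-- In a morphism of short exact sequences which is the identity on the right, the left square is
a pushout. -/
lemma isPushout_of_shortExact {X Y X' Y' Z : C} {f : X ⟶ Y} {g : Y ⟶ Z} {w : f ≫ g = 0}
    {f' : X' ⟶ Y'} {g' : Y' ⟶ Z} {w' : f' ≫ g' = 0}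
    (h : (ShortComplex.mk f g w).ShortExact) (h' : (ShortComplex.mk f' g' w').ShortExact)
    (a : X ⟶ X') (b : Y ⟶ Y') (h₁ : f ≫ b = a ≫ f') (h₂ : b ≫ g' = g) :
    IsPushout f a b f' := by
  obtain ⟨E, i, q, wE, k, hE, hpo, hkq⟩ := exists_pushout h a
  dsimp at q wE k hE hpo hkq
  let φ : ShortComplex.mk i q wE ⟶ ShortComplex.mk f' g' w' :=
    { τ₁ := 𝟙 _
      τ₂ := hpo.desc b f' h₁
      τ₃ := 𝟙 _
      comm₁₂ := by simp
      comm₂₃ := by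
        dsimp
        apply hpo.hom_ext <;> simp [h₂, hkq, w', wE] }
  have : IsIso φ.τ₁ := inferInstanceAs (IsIso (𝟙 _))
  have : IsIso φ.τ₃ := inferInstanceAs (IsIso (𝟙 _))
  have := ShortComplex.isIso₂_of_shortExact_of_isIso₁₃ φ hE h'
  exact hpo.of_iso (Iso.refl _) (Iso.refl _) (Iso.refl _) (asIso φ.τ₂)
    (by simp) (by simp) (by simp [φ]) (by simp [φ])

/-- In a commutative diagram with exact rows, the cokernels of the columns form a short exact
sequence as soon as the right column is a monomorphism. -/
lemma shortExact_cokernels {S S' : ShortComplex C} (φ : S ⟶ S') (hS : S.Exact) [Epi S.g]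
    (hS' : S'.ShortExact) [Mono φ.τ₃] :
    (ShortComplex.mk
      (cokernel.map φ.τ₁ φ.τ₂ S.f S'.f φ.comm₁₂)
      (cokernel.map φ.τ₂ φ.τ₃ S.g S'.g φ.comm₂₃)
      (by ext; simp)).ShortExact := by
  have := hS'.mono_f
  have := hS'.epi_g
  have ex : ∀ {X Y : C} (f : X ⟶ Y), (ShortComplex.mk f (cokernel.π f) (by simp)).Exact :=
    fun f => ShortComplex.exact_of_g_is_cokernel _ (cokernelIsCokernel f)
  have hmono : Mono (cokernel.map φ.τ₁ φ.τ₂ S.f S'.f φ.comm₁₂) := by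
    refine Preadditive.mono_of_cancel_zero _ fun {T} t ht => ?_
    obtain ⟨T₁, π₁, _, x, hx⟩ := surjective_up_to_refinements_of_epi (cokernel.π φ.τ₁) t
    have h1 : (x ≫ S'.f) ≫ cokernel.π φ.τ₂ = 0 := by
      have : π₁ ≫ t ≫ cokernel.map φ.τ₁ φ.τ₂ S.f S'.f φ.comm₁₂ = 0 := by rw [ht, comp_zero]
      rw [reassoc_of% hx] at this
      simpa using this
    obtain ⟨T₂, π₂, _, y, hy⟩ := (ex φ.τ₂).exact_up_to_refinements _ h1
    dsimp at y hy
    have h2 : y ≫ S.g = 0 := by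
      rw [← cancel_mono φ.τ₃, Category.assoc, ← φ.comm₂₃, ← reassoc_of% hy]; simp
    obtain ⟨T₃, π₃, _, z, hz⟩ := hS.exact_up_to_refinements _ h2
    have h3 : π₃ ≫ π₂ ≫ x = z ≫ φ.τ₁ := by
      rw [← cancel_mono S'.f]
      simp only [Category.assoc, hy, reassoc_of% hz, φ.comm₁₂]
    rw [← cancel_epi π₁, ← cancel_epi π₂, ← cancel_epi π₃, hx, reassoc_of% h3]
    simp
  have hepi : Epi (cokernel.map φ.τ₂ φ.τ₃ S.g S'.g φ.comm₂₃) :=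
    epi_of_epi_fac (f := cokernel.π φ.τ₂) (h := S'.g ≫ cokernel.π φ.τ₃) (by simp)
  refine .mk' (ShortComplex.exact_of_g_is_cokernel _ ?_) hmono hepi
  refine CokernelCofork.IsColimit.ofπ' _ _ fun {T} t ht => ?_
  have h0 : S'.f ≫ cokernel.π φ.τ₂ ≫ t = 0 := by
    have : cokernel.π φ.τ₁ ≫ cokernel.map φ.τ₁ φ.τ₂ S.f S'.f φ.comm₁₂ ≫ t = 0 := by
      rw [show cokernel.map φ.τ₁ φ.τ₂ S.f S'.f φ.comm₁₂ ≫ t = 0 from ht, comp_zero]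
    simpa using this
  obtain ⟨l, hl⟩ := CokernelCofork.IsColimit.desc' hS'.gIsCokernel _ h0
  dsimp at l hl
  have h1 : φ.τ₃ ≫ l = 0 := by
    rw [← cancel_epi S.g, ← φ.comm₂₃_assoc, hl]; simp
  refine ⟨cokernel.desc _ l h1, ?_⟩
  ext
  simpa using hl

/-- In a commutative diagram with exact rows, the kernels of the columns form a short exact
sequence as soon as the left column is an epimorphism. -/
lemma shortExact_kernels {S S' : ShortComplex C} (φ : S ⟶ S') (hS : S.ShortExact)
    (hS' : S'.Exact) [Mono S'.f] [Epi φ.τ₁] :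
    (ShortComplex.mk
      (kernel.map φ.τ₁ φ.τ₂ S.f S'.f φ.comm₁₂)
      (kernel.map φ.τ₂ φ.τ₃ S.g S'.g φ.comm₂₃)
      (by ext; simp)).ShortExact := by
  have := hS.mono_f
  have := hS.epi_g
  have hmono : Mono (kernel.map φ.τ₁ φ.τ₂ S.f S'.f φ.comm₁₂) := by
    have : Mono (kernel.map φ.τ₁ φ.τ₂ S.f S'.f φ.comm₁₂ ≫ kernel.ι φ.τ₂) := by
      rw [kernel.lift_ι]
      infer_instance
    exact mono_of_mono _ (kernel.ι φ.τ₂)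
  have hepi : Epi (kernel.map φ.τ₂ φ.τ₃ S.g S'.g φ.comm₂₃) := by
    rw [epi_iff_surjective_up_to_refinements]
    intro T t
    obtain ⟨T₁, π₁, _, x, hx⟩ := surjective_up_to_refinements_of_epi S.g (t ≫ kernel.ι φ.τ₃)
    have h1 : (x ≫ φ.τ₂) ≫ S'.g = 0 := by
      rw [Category.assoc, φ.comm₂₃, ← reassoc_of% hx]; simp
    obtain ⟨T₂, π₂, _, y, hy⟩ := hS'.exact_up_to_refinements _ h1
    obtain ⟨T₃, π₃, _, z, hz⟩ := surjective_up_to_refinements_of_epi φ.τ₁ y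
    refine ⟨T₃, π₃ ≫ π₂ ≫ π₁, inferInstance,
      kernel.lift _ (π₃ ≫ π₂ ≫ x - z ≫ S.f) ?_, ?_⟩
    · simp only [Preadditive.sub_comp, Category.assoc, hy, ← φ.comm₁₂, reassoc_of% hz, sub_self]
    · ext
      simp [hx]
  refine .mk' (ShortComplex.exact_of_f_is_kernel _ ?_) hmono hepi
  refine KernelFork.IsLimit.ofι' _ _ fun {T} t ht => ?_
  have h0 : (t ≫ kernel.ι φ.τ₂) ≫ S.g = 0 := by
    have : t ≫ kernel.map φ.τ₂ φ.τ₃ S.g S'.g φ.comm₂₃ ≫ kernel.ι φ.τ₃ = 0 := by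
      rw [← Category.assoc, show t ≫ kernel.map φ.τ₂ φ.τ₃ S.g S'.g φ.comm₂₃ = 0 from ht,
        zero_comp]
    simpa using this
  obtain ⟨l, hl⟩ := KernelFork.IsLimit.lift' hS.fIsKernel _ h0
  dsimp at l hl
  have h1 : l ≫ φ.τ₁ = 0 := by
    rw [← cancel_mono S'.f, Category.assoc, φ.comm₁₂, reassoc_of% hl]; simp
  refine ⟨kernel.lift _ l h1, ?_⟩
  ext
  simpa using hl

/-- The kernel of a composite `f ≫ g` with `f` an epimorphism is an extension of the kernel of `g`
by the kernel of `f`. -/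
lemma shortExact_kernel_comp {X Y Z : C} (f : X ⟶ Y) (g : Y ⟶ Z) [Epi f] :
    (ShortComplex.mk (kernel.map f (f ≫ g) (𝟙 X) g (by simp))
      (kernel.map (f ≫ g) g f (𝟙 Z) (by simp)) (by ext; simp)).ShortExact := by
  have hm : Mono (kernel.map f (f ≫ g) (𝟙 X) g (by simp)) := by
    have : Mono (kernel.map f (f ≫ g) (𝟙 X) g (by simp) ≫ kernel.ι (f ≫ g)) := by
      rw [kernel.lift_ι]
      infer_instance
    exact mono_of_mono _ (kernel.ι (f ≫ g))
  refine .mk' (ShortComplex.exact_of_f_is_kernel _ ?_) hm ?_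
  · refine KernelFork.IsLimit.ofι' _ _ fun {T} t ht => ?_
    have h0 : (t ≫ kernel.ι (f ≫ g)) ≫ f = 0 := by
      have := congr($ht ≫ kernel.ι g)
      simpa using this
    exact ⟨kernel.lift _ _ h0, by ext; simp⟩
  rw [epi_iff_surjective_up_to_refinements]
  intro T t
  obtain ⟨T₁, π₁, _, x, hx⟩ := surjective_up_to_refinements_of_epi f (t ≫ kernel.ι g)
  refine ⟨T₁, π₁, inferInstance, kernel.lift _ x ?_, ?_⟩
  · rw [← reassoc_of% hx]; simp
  · ext
    simp [hx]

/-- Componentwise direct sums of short exact sequences are short exact. -/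
lemma shortExact_biprod_map {S S' : ShortComplex C} (hS : S.ShortExact) (hS' : S'.ShortExact) :
    (ShortComplex.mk (biprod.map S.f S'.f) (biprod.map S.g S'.g)
      (by ext <;> simp)).ShortExact := by
  have := hS.mono_f
  have := hS.epi_g
  have := hS'.mono_f
  have := hS'.epi_g
  refine .mk' (ShortComplex.exact_of_f_is_kernel _ ?_) inferInstance inferInstance
  refine KernelFork.IsLimit.ofι' _ _ fun {T} t ht => ?_
  have h1 : (t ≫ biprod.fst) ≫ S.g = 0 := by
    have := congr($ht ≫ biprod.fst); simpa using this
  have h2 : (t ≫ biprod.snd) ≫ S'.g = 0 := by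
    have := congr($ht ≫ biprod.snd); simpa using this
  obtain ⟨l, hl⟩ := KernelFork.IsLimit.lift' hS.fIsKernel _ h1
  obtain ⟨l', hl'⟩ := KernelFork.IsLimit.lift' hS'.fIsKernel _ h2
  dsimp at l hl l' hl'
  exact ⟨biprod.lift l l', by ext <;> simp [hl, hl']⟩

end ShortExact

/-! ### Vanishing of `Ext¹` -/

section Ext

variable {C : Type u} [Category.{v} C] [Abelian C]

/-- The group `Ext¹(G, M)` is zero. -/
def Ext1Vanishes (G M : C) : Prop :=
  haveI : HasExt.{max u v} C := HasExt.standard C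
  Subsingleton (Abelian.Ext.{max u v} G M 1)

namespace Ext1Vanishes

open Abelian

lemma exists_extension {S : ShortComplex C} (hS : S.ShortExact) {M : C}
    (h : Ext1Vanishes S.X₃ M) (f : S.X₁ ⟶ M) : ∃ g : S.X₂ ⟶ M, S.f ≫ g = f := by
  let : HasExt.{max u v} C := HasExt.standard C
  have : Subsingleton (Ext.{max u v} S.X₃ M 1) := h
  obtain ⟨x, hx⟩ := Ext.contravariant_sequence_exact₁ hS M (Ext.mk₀ f) (add_zero 1)
    (Subsingleton.elim _ _)
  obtain ⟨g, rfl⟩ := Ext.addEquiv₀.symm.surjective x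
  refine ⟨g, Ext.addEquiv₀.symm.injective ?_⟩
  simpa using hx

lemma exists_lift {S : ShortComplex C} (hS : S.ShortExact) {G : C}
    (h : Ext1Vanishes G S.X₁) (f : G ⟶ S.X₃) : ∃ g : G ⟶ S.X₂, g ≫ S.g = f := by
  let : HasExt.{max u v} C := HasExt.standard C
  have : Subsingleton (Ext.{max u v} G S.X₁ 1) := h
  obtain ⟨x, hx⟩ := Ext.covariant_sequence_exact₃ G hS (Ext.mk₀ f) (zero_add 1)
    (Subsingleton.elim _ _)
  obtain ⟨g, rfl⟩ := Ext.addEquiv₀.symm.surjective x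
  refine ⟨g, Ext.addEquiv₀.symm.injective ?_⟩
  simpa using hx

lemma of_exists_extension {S : ShortComplex C} (hS : S.ShortExact) (hP : Projective S.X₂) {M : C}
    (h : ∀ f : S.X₁ ⟶ M, ∃ g : S.X₂ ⟶ M, S.f ≫ g = f) : Ext1Vanishes S.X₃ M := by
  let : HasExt.{max u v} C := HasExt.standard C
  refine subsingleton_of_forall_eq (0 : Ext.{max u v} S.X₃ M 1) fun x => ?_
  obtain ⟨y, rfl⟩ := Ext.contravariant_sequence_exact₃ hS M x
    (Ext.eq_zero_of_projective _) (add_zero 1)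
  obtain ⟨f, rfl⟩ := Ext.addEquiv₀.symm.surjective y
  obtain ⟨g, rfl⟩ := h f
  simp [← Ext.mk₀_comp_mk₀]

/-- With enough projectives, `Ext¹(G, M)` vanishes if every extension of `G` by `M` splits. -/
lemma of_splits [EnoughProjectives C] {G M : C}
    (h : ∀ {E : C} (i : M ⟶ E) (q : E ⟶ G) (w : i ≫ q = 0),
      (ShortComplex.mk i q w).ShortExact → ∃ s : G ⟶ E, s ≫ q = 𝟙 G) : Ext1Vanishes G M := by
  have hS := shortExact_kernel (Projective.π G)
  refine of_exists_extension hS (inferInstanceAs (Projective (Projective.over G))) fun f => ?_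
  obtain ⟨E, i, q, w, k, hE, hpo, hk⟩ := exists_pushout hS f
  obtain ⟨s, hs⟩ := h i q w hE
  obtain ⟨r, hr⟩ : ∃ r : E ⟶ M, i ≫ r = 𝟙 M := by
    let σ := ShortComplex.Splitting.ofExactOfSection _ hE.exact s hs hE.mono_f
    exact ⟨σ.r, σ.f_r⟩
  refine ⟨k ≫ r, ?_⟩
  rw [hpo.w_assoc, hr, Category.comp_id]

lemma of_projective (P M : C) (hP : Projective P) : Ext1Vanishes P M := by
  let : HasExt.{max u v} C := HasExt.standard C
  exact Ext.subsingleton_of_projective P M 0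

lemma of_injective (G I : C) (hI : Injective I) : Ext1Vanishes G I := by
  let : HasExt.{max u v} C := HasExt.standard C
  exact Ext.subsingleton_of_injective G I 0

lemma middle_left {S : ShortComplex C} (hS : S.ShortExact) {M : C}
    (h₁ : Ext1Vanishes S.X₁ M) (h₃ : Ext1Vanishes S.X₃ M) : Ext1Vanishes S.X₂ M := by
  let : HasExt.{max u v} C := HasExt.standard C
  have : Subsingleton (Ext.{max u v} S.X₁ M 1) := h₁
  have : Subsingleton (Ext.{max u v} S.X₃ M 1) := h₃
  refine subsingleton_of_forall_eq (0 : Ext.{max u v} S.X₂ M 1) fun x => ?_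
  obtain ⟨y, rfl⟩ := Ext.contravariant_sequence_exact₂ hS M x (Subsingleton.elim _ _)
  simp [Subsingleton.elim y 0]

lemma middle_right {S : ShortComplex C} (hS : S.ShortExact) {G : C}
    (h₁ : Ext1Vanishes G S.X₁) (h₃ : Ext1Vanishes G S.X₃) : Ext1Vanishes G S.X₂ := by
  let : HasExt.{max u v} C := HasExt.standard C
  have : Subsingleton (Ext.{max u v} G S.X₁ 1) := h₁
  have : Subsingleton (Ext.{max u v} G S.X₃ 1) := h₃
  refine subsingleton_of_forall_eq (0 : Ext.{max u v} G S.X₂ 1) fun x => ?_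
  obtain ⟨y, rfl⟩ := Ext.covariant_sequence_exact₂ G hS x (Subsingleton.elim _ _)
  simp [Subsingleton.elim y 0]

lemma biprod {G M N : C} (hM : Ext1Vanishes G M) (hN : Ext1Vanishes G N) :
    Ext1Vanishes G (M ⊞ N) :=
  middle_right (shortExact_biprod M N) hM hN

lemma of_retract_right {G M N : C} (h : Ext1Vanishes G M) (r : Retract N M) :
    Ext1Vanishes G N := by
  let : HasExt.{max u v} C := HasExt.standard C
  have : Subsingleton (Ext.{max u v} G M 1) := h
  refine subsingleton_of_forall_eq (0 : Ext.{max u v} G N 1) fun x => ?_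
  have h1 : (x.comp (Ext.mk₀ r.i) (add_zero 1)).comp (Ext.mk₀ r.r) (add_zero 1) = x := by simp
  rw [← h1, Subsingleton.elim (x.comp (Ext.mk₀ r.i) (add_zero 1)) 0, Ext.zero_comp]

lemma of_iso_left {G G' M : C} (h : Ext1Vanishes G M) (e : G' ≅ G) : Ext1Vanishes G' M := by
  let : HasExt.{max u v} C := HasExt.standard C
  have : Subsingleton (Ext.{max u v} G M 1) := h
  refine subsingleton_of_forall_eq (0 : Ext.{max u v} G' M 1) fun x => ?_
  have h1 : (Ext.mk₀ e.hom).comp ((Ext.mk₀ e.inv).comp x (zero_add 1)) (zero_add 1) = x := by simp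
  rw [← h1, Subsingleton.elim ((Ext.mk₀ e.inv).comp x (zero_add 1)) 0, Ext.comp_zero]

end Ext1Vanishes

end Ext

/-! ### The comma category -/

section Comma

set_option linter.unusedSectionVars false

variable {A : Type u₁} [Category.{v₁} A] [Abelian A]
variable {B : Type u₂} [Category.{v₂} B] [Abelian B]
variable (T : B ⥤ A)

instance preservesFiniteLimits_fst : PreservesFiniteLimits (Comma.fst T (𝟭 A)) where
  preservesFiniteLimits _ := inferInstance

instance preservesFiniteLimits_snd : PreservesFiniteLimits (Comma.snd T (𝟭 A)) where
  preservesFiniteLimits _ := inferInstance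

lemma mono_of_components {E F : CommaCat T} (f : E ⟶ F) [Mono f.left] [Mono f.right] : Mono f where
  right_cancellation g h w := by
    ext
    · rw [← cancel_mono f.left]; exact congr($(w).left)
    · rw [← cancel_mono f.right]; exact congr($(w).right)

lemma epi_of_components {E F : CommaCat T} (f : E ⟶ F) [Epi f.left] [Epi f.right] : Epi f where
  left_cancellation g h w := by
    ext
    · rw [← cancel_epi f.left]; exact congr($(w).left)
    · rw [← cancel_epi f.right]; exact congr($(w).right)

variable [T.Additive] [PreservesFiniteColimits T]

instance preservesFiniteColimits_fst : PreservesFiniteColimits (Comma.fst T (𝟭 A)) where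
  preservesFiniteColimits _ := inferInstance

instance preservesFiniteColimits_snd : PreservesFiniteColimits (Comma.snd T (𝟭 A)) where
  preservesFiniteColimits _ := inferInstance

instance additive_fst : (Comma.fst T (𝟭 A)).Additive where

instance additive_snd : (Comma.snd T (𝟭 A)).Additive where

variable {T}

lemma isZero_of_components {E : CommaCat T} (h₁ : IsZero E.left) (h₂ : IsZero E.right) :
    IsZero E := by
  rw [IsZero.iff_id_eq_zero]
  ext
  · exact h₁.eq_of_src _ _
  · exact h₂.eq_of_src _ _

lemma shortExact_left {S : ShortComplex (CommaCat T)} (hS : S.ShortExact) :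
    (ShortComplex.mk S.f.left S.g.left congr($(S.zero).left)).ShortExact :=
  hS.map_of_exact (Comma.fst T (𝟭 A))

lemma shortExact_right {S : ShortComplex (CommaCat T)} (hS : S.ShortExact) :
    (ShortComplex.mk S.f.right S.g.right congr($(S.zero).right)).ShortExact :=
  hS.map_of_exact (Comma.snd T (𝟭 A))

lemma comma_shortExact {E F G : CommaCat T} {f : E ⟶ F} {g : F ⟶ G} (w : f ≫ g = 0)
    (w₁ : f.left ≫ g.left = 0) (w₂ : f.right ≫ g.right = 0)
    (h₁ : (ShortComplex.mk f.left g.left w₁).ShortExact)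
    (h₂ : (ShortComplex.mk f.right g.right w₂).ShortExact) :
    (ShortComplex.mk f g w).ShortExact := by
  have : Mono f.left := h₁.mono_f
  have : Mono f.right := h₂.mono_f
  have : Epi g.left := h₁.epi_g
  have : Epi g.right := h₂.epi_g
  refine .mk' ?_ (mono_of_components T f) (epi_of_components T g)
  rw [ShortComplex.exact_iff_isZero_homology]
  apply isZero_of_components
  · refine IsZero.of_iso ?_ ((ShortComplex.mk f g w).mapHomologyIso (Comma.fst T (𝟭 A))).symm
    exact (ShortComplex.exact_iff_isZero_homology _).1 h₁.exact
  · refine IsZero.of_iso ?_ ((ShortComplex.mk f g w).mapHomologyIso (Comma.snd T (𝟭 A))).symm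
    exact (ShortComplex.exact_iff_isZero_homology _).1 h₂.exact

instance {E F : CommaCat T} (f : E ⟶ F) [Epi f] : Epi f.left :=
  inferInstanceAs (Epi ((Comma.fst T (𝟭 A)).map f))

instance {E F : CommaCat T} (f : E ⟶ F) [Epi f] : Epi f.right :=
  inferInstanceAs (Epi ((Comma.snd T (𝟭 A)).map f))

instance {E F : CommaCat T} (f : E ⟶ F) [Mono f] : Mono f.left :=
  inferInstanceAs (Mono ((Comma.fst T (𝟭 A)).map f))

instance {E F : CommaCat T} (f : E ⟶ F) [Mono f] : Mono f.right :=
  inferInstanceAs (Mono ((Comma.snd T (𝟭 A)).map f))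

/-- A right exact functor turns a short exact sequence into an exact sequence. -/
lemma exact_map_of_shortExact {S : ShortComplex B} (hS : S.ShortExact) : (S.map T).Exact :=
  have := hS.epi_g
  hS.exact.map_of_epi_of_preservesCokernel T inferInstance inferInstance

lemma shortExact_map_of_mono {S : ShortComplex B} (hS : S.ShortExact) (h : Mono (T.map S.f)) :
    (S.map T).ShortExact :=
  have := hS.epi_g
  .mk' (exact_map_of_shortExact hS) h (inferInstanceAs (Epi (T.map S.g)))

/-- The structure morphism `T(E.left) ⟶ E.right` of an object `E` of the comma category. -/
def str (E : CommaCat T) : T.obj E.left ⟶ E.right := E.hom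

lemma str_comm {E F : CommaCat T} (f : E ⟶ F) : T.map f.left ≫ str F = str E ≫ f.right := f.w

/-- The morphism `𝐩(M, N) ⟶ E` given by its components `M ⟶ E.right` and `N ⟶ E.left`: the
functor `𝐩` is left adjoint to the forgetful functor to `𝒜 × ℬ`. -/
noncomputable def pDesc {M : A} {N : B} {E : CommaCat T} (a : M ⟶ E.right) (b : N ⟶ E.left) :
    (p T).obj (M, N) ⟶ E where
  left := b
  right := biprod.desc a (T.map b ≫ str E)
  w := (biprod.inr_desc _ _).symm

lemma p_hom_ext {M : A} {N : B} {E : CommaCat T} {f g : (p T).obj (M, N) ⟶ E}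
    (h₁ : (biprod.inl : M ⟶ M ⊞ T.obj N) ≫ f.right = biprod.inl ≫ g.right)
    (h₂ : f.left = g.left) : f = g := by
  ext
  · exact h₂
  · apply biprod.hom_ext'
    · exact h₁
    · have hf := f.w
      have hg := g.w
      dsimp at hf hg
      exact hf.symm.trans (by rw [h₂]; exact hg)

lemma projective_p {P : A} {Q : B} (hP : Projective P) (hQ : Projective Q) :
    Projective ((p T).obj (P, Q)) where
  factors {E F} f e he := by
    obtain ⟨a, ha⟩ := hP.factors ((biprod.inl : P ⟶ P ⊞ T.obj Q) ≫ f.right) e.right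
    obtain ⟨b, hb⟩ := hQ.factors f.left e.left
    exact ⟨pDesc a b, p_hom_ext ((biprod.inl_desc_assoc _ _ _).trans ha) hb⟩

lemma exists_epi_p [EnoughProjectives A] [EnoughProjectives B] (E : CommaCat T) :
    ∃ (P : A) (Q : B) (f : (p T).obj (P, Q) ⟶ E), Projective P ∧ Projective Q ∧ Epi f := by
  refine ⟨Projective.over E.right, Projective.over E.left,
    pDesc (Projective.π _) (Projective.π _), inferInstance, inferInstance, ?_⟩
  have : Epi (pDesc (Projective.π E.right) (Projective.π E.left)).left :=
    inferInstanceAs (Epi (Projective.π E.left))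
  have : Epi (pDesc (Projective.π E.right) (Projective.π E.left)).right :=
    epi_of_epi_fac (biprod.inl_desc (Projective.π E.right) (T.map (Projective.π E.left) ≫ str E))
  exact epi_of_components T _

instance enoughProjectives_comma [EnoughProjectives A] [EnoughProjectives B] :
    EnoughProjectives (CommaCat T) where
  presentation E := by
    obtain ⟨P, Q, f, hP, hQ, hf⟩ := exists_epi_p E
    exact ⟨{ p := _, projective := projective_p hP hQ, f := f, epi := hf }⟩

lemma exists_retract_p [EnoughProjectives A] [EnoughProjectives B] (E : CommaCat T)
    (hE : Projective E) :
    ∃ (P : A) (Q : B), Projective P ∧ Projective Q ∧ Nonempty (Retract E ((p T).obj (P, Q))) := by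
  obtain ⟨P, Q, f, hP, hQ, hf⟩ := exists_epi_p E
  exact ⟨P, Q, hP, hQ, ⟨⟨Projective.factorThru (𝟙 E) f, f, by simp⟩⟩⟩

lemma projective_left [EnoughProjectives A] [EnoughProjectives B] {E : CommaCat T}
    (hE : Projective E) : Projective E.left := by
  obtain ⟨P, Q, hP, hQ, ⟨r⟩⟩ := exists_retract_p E hE
  exact (r.map (Comma.fst T (𝟭 A))).projective (p := hQ)

lemma mono_str_of_projective [EnoughProjectives A] [EnoughProjectives B] {E : CommaCat T}
    (hE : Projective E) : Mono (str E) := by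
  obtain ⟨P, Q, hP, hQ, ⟨r⟩⟩ := exists_retract_p E hE
  have h : T.map r.i.left ≫ T.map r.r.left = 𝟙 _ := by
    rw [← T.map_comp, ← Comma.comp_left, r.retract]; simp
  have := mono_of_mono_fac h
  have hw : T.map r.i.left ≫ (biprod.inr : T.obj Q ⟶ P ⊞ T.obj Q) = str E ≫ r.i.right := r.i.w
  have : Mono (str E ≫ r.i.right) := by
    rw [← hw]
    exact mono_comp' this (inferInstanceAs (Mono (biprod.inr : T.obj Q ⟶ P ⊞ T.obj Q)))
  exact mono_of_mono _ r.i.right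

/-- The object `(M, 0)` of the comma category. -/
noncomputable def ofRight (T : B ⥤ A) (M : A) : CommaCat T where
  left := 0
  right := M
  hom := 0

/-- Morphisms `E ⟶ (M, 0)` are the morphisms `E.right ⟶ M` killing the structure morphism. -/
noncomputable def toOfRight {E : CommaCat T} {M : A} (f : E.right ⟶ M) (h : str E ≫ f = 0) :
    E ⟶ ofRight T M where
  left := 0
  right := f
  w := by
    change T.map 0 ≫ 0 = str E ≫ f
    rw [h, comp_zero]

lemma projective_cokernel_str {E : CommaCat T} (hE : Projective E) :
    Projective (cokernel (str E)) where
  factors {M N} f e he := by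
    let e' : ofRight T M ⟶ ofRight T N :=
      { left := 0
        right := e
        w := (T.map_isZero (isZero_zero B)).eq_of_src _ _ }
    have : Epi e'.left := ⟨fun _ _ _ => IsZero.eq_of_src (isZero_zero B) _ _⟩
    have : Epi e'.right := he
    have : Epi e' := epi_of_components T e'
    obtain ⟨g, hg⟩ := hE.factors
      (toOfRight (cokernel.π (str E) ≫ f) (cokernel.condition_assoc _ _ |>.trans zero_comp)) e'
    have hw : str E ≫ (g.right : E.right ⟶ M) = 0 := g.w.symm.trans comp_zero
    refine ⟨cokernel.desc _ g.right hw, ?_⟩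
    ext
    refine (cokernel.π_desc_assoc _ _ hw _).trans ?_
    exact congr($(hg).right)

lemma projective_ofRight {P : A} (hP : Projective P) : Projective (ofRight T P) where
  factors {E F} f e he := by
    obtain ⟨a, ha⟩ := hP.factors f.right e.right
    refine ⟨{ left := 0, right := a, w := IsZero.eq_of_src (T.map_isZero (isZero_zero B)) _ _ }, ?_⟩
    ext
    · exact IsZero.eq_of_src (isZero_zero B) _ _
    · exact ha

/-- The morphism `𝐩(a, b)`. -/
noncomputable abbrev pMap {M M' : A} {N N' : B} (a : M ⟶ M') (b : N ⟶ N') :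
    (p T).obj (M, N) ⟶ (p T).obj (M', N') :=
  (p T).map (X := (M, N)) (Y := (M', N')) (a, b)

lemma pMap_comp_eq_zero {M M' M'' : A} {N N' N'' : B} {a : M ⟶ M'} {a' : M' ⟶ M''}
    {b : N ⟶ N'} {b' : N' ⟶ N''} (h : a ≫ a' = 0) (h' : b ≫ b' = 0) :
    (pMap a b : (p T).obj _ ⟶ _) ≫ pMap a' b' = 0 := by
  have h₂ : biprod.map a (T.map b) ≫ biprod.map a' (T.map b') = 0 := by
    ext <;> simp [h, h', ← T.map_comp]
  ext
  · exact h'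
  · exact h₂

/-- The functor `𝐩` preserves short exact sequences whose second component stays short exact
under `T`. -/
lemma shortExact_p {S : ShortComplex A} {S' : ShortComplex B} (hS : S.ShortExact)
    (hS' : S'.ShortExact) (hT : (S'.map T).ShortExact) :
    (ShortComplex.mk (pMap S.f S'.f) (pMap S.g S'.g) (pMap_comp_eq_zero S.zero S'.zero) :
      ShortComplex (CommaCat T)).ShortExact :=
  comma_shortExact (pMap_comp_eq_zero S.zero S'.zero) S'.zero
    congr($(pMap_comp_eq_zero (T := T) S.zero S'.zero).right) hS' (shortExact_biprod_map hS hT)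

/-- Since `𝐩` is left adjoint to the forgetful functor, an extension of `𝐩(M, N)` by `K` splits as
soon as its two components do. -/
lemma ext1Vanishes_p [EnoughProjectives A] [EnoughProjectives B] {M : A} {N : B} {K : CommaCat T}
    (hM : Ext1Vanishes M K.right) (hN : Ext1Vanishes N K.left) :
    Ext1Vanishes ((p T).obj (M, N)) K := by
  refine Ext1Vanishes.of_splits fun {E} i q w h => ?_
  obtain ⟨a, ha⟩ := Ext1Vanishes.exists_lift (shortExact_right h) hM
    (biprod.inl : M ⟶ M ⊞ T.obj N)
  obtain ⟨b, hb⟩ := Ext1Vanishes.exists_lift (shortExact_left h) hN (𝟙 N)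
  exact ⟨pDesc a b, p_hom_ext
    (((biprod.inl_desc_assoc _ _ _).trans ha).trans (Category.comp_id _).symm) hb⟩

/-- An extension of `M` by `K.right` underlies an extension of `(M, 0)` by `K`. -/
lemma Ext1Vanishes.right_of_p [EnoughProjectives A] {M : A} {N : B} {K : CommaCat T}
    (hN : IsZero N) (h : Ext1Vanishes ((p T).obj (M, N)) K) : Ext1Vanishes M K.right := by
  refine Ext1Vanishes.of_splits fun {R} i q w hR => ?_
  -- The extension of `𝐩(M, N) ≅ (M, 0)` by `K` with `K.left` unchanged.
  let E : CommaCat T := { left := K.left, right := R, hom := str K ≫ i }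
  let f : K ⟶ E := { left := 𝟙 _, right := i }
  let g : E ⟶ (p T).obj (M, N) :=
    { left := 0
      right := q ≫ biprod.inl
      w := by
        change T.map 0 ≫ biprod.inr = (str K ≫ i) ≫ q ≫ biprod.inl
        rw [T.map_zero, zero_comp, Category.assoc, reassoc_of% w, zero_comp, comp_zero] }
  have hiso : IsIso (biprod.inl : M ⟶ M ⊞ T.obj N) := by
    refine ⟨biprod.fst, by simp, ?_⟩
    ext
    · simp
    · simp
    · exact (T.map_isZero hN).eq_of_src _ _
    · exact (T.map_isZero hN).eq_of_src _ _
  have hf : f ≫ g = 0 := by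
    ext
    · exact hN.eq_of_tgt _ _
    · change i ≫ q ≫ biprod.inl = 0
      rw [reassoc_of% w, zero_comp]
  have hE : (ShortComplex.mk f g hf).ShortExact := by
    refine comma_shortExact hf congr($(hf).left) congr($(hf).right) ?_ ?_
    · have : Mono f.left := inferInstanceAs (Mono (𝟙 K.left))
      have : Epi f.left := inferInstanceAs (Epi (𝟙 K.left))
      have : Epi g.left := ⟨fun _ _ _ => hN.eq_of_src _ _⟩
      exact .mk' ((ShortComplex.exact_iff_epi _ (hN.eq_of_tgt _ _)).2 ‹_›) ‹_› ‹_›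
    · exact shortExact_of_iso_right hR (asIso (biprod.inl : M ⟶ M ⊞ T.obj N)) _
  obtain ⟨s, hs⟩ := h.exists_lift hE (𝟙 _)
  refine ⟨(biprod.inl : M ⟶ M ⊞ T.obj N) ≫ s.right, ?_⟩
  have h1 : s.right ≫ q ≫ (biprod.inl : M ⟶ M ⊞ T.obj N) = 𝟙 (M ⊞ T.obj N) :=
    congr($(hs).right)
  have h2 := congr((biprod.inl : M ⟶ M ⊞ T.obj N) ≫ $h1 ≫ biprod.fst)
  rw [Category.id_comp, biprod.inl_fst] at h2
  refine Eq.trans ?_ h2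
  erw [Category.assoc, Category.assoc, Category.assoc, biprod.inl_fst, Category.comp_id]

/-- An extension of `N` by `K.left` which stays short exact under `T` underlies an extension of
`𝐩(0, N)` by `K`. -/
lemma Ext1Vanishes.left_of_p [EnoughProjectives B] {M : A} {N : B} {K : CommaCat T}
    (hM : IsZero M) (hT : ∀ S : ShortComplex B, S.ShortExact → S.X₃ = N → (S.map T).ShortExact)
    (h : Ext1Vanishes ((p T).obj (M, N)) K) : Ext1Vanishes N K.left := by
  refine Ext1Vanishes.of_splits fun {R} i q w hR => ?_
  have hTR := hT _ hR rfl
  -- Push out the image of the given extension under `T` along the structure morphism of `K`.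
  obtain ⟨E', i', q', w', k, hE', hpo, hk⟩ := exists_pushout hTR (str K)
  let E : CommaCat T := { left := R, right := E', hom := k }
  let f : K ⟶ E := { left := i, right := i', w := hpo.w }
  let g : E ⟶ (p T).obj (M, N) :=
    { left := q
      right := q' ≫ biprod.inr
      w := by
        change T.map q ≫ biprod.inr = k ≫ q' ≫ biprod.inr
        rw [reassoc_of% hk]
        rfl }
  have hiso : IsIso (biprod.inr : T.obj N ⟶ M ⊞ T.obj N) := by
    refine ⟨biprod.snd, by simp, ?_⟩
    ext
    · exact hM.eq_of_src _ _
    · exact hM.eq_of_src _ _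
    · simp
    · simp
  have hf : f ≫ g = 0 := by
    ext
    · exact w
    · change i' ≫ q' ≫ biprod.inr = 0
      rw [reassoc_of% w', zero_comp]
  have hE : (ShortComplex.mk f g hf).ShortExact := by
    refine comma_shortExact hf congr($(hf).left) congr($(hf).right) hR ?_
    let e : T.obj N ≅ M ⊞ T.obj N := asIso biprod.inr
    exact shortExact_of_iso_right hE' e _
  obtain ⟨s, hs⟩ := h.exists_lift hE (𝟙 _)
  exact ⟨s.left, congr($(hs).left)⟩

end Comma

/-! ### Special precovers in the comma category -/

section SpecialPrecover

set_option linter.unusedSectionVars false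

variable {A : Type u₁} [Category.{v₁} A] [Abelian A]
variable {B : Type u₂} [Category.{v₂} B] [Abelian B]
variable {T : B ⥤ A} [T.Additive] [PreservesFiniteColimits T]

/-- An object of the comma category whose structure morphism is a monomorphism with cokernel
in `𝒳`, lying over an object of `𝒴`, belongs to `⟨𝐩(𝒳, 𝒴)⟩`. -/
lemma extP_of_shortExact {X : ObjectProperty A} {Y : ObjectProperty B} (hX : X.ContainsZero)
    (hY : Y.ContainsZero) {E : CommaCat T} {M : A} (q : E.right ⟶ M) (w : str E ≫ q = 0)
    (h : (ShortComplex.mk (str E) q w).ShortExact) (hM : X M) (hE : Y E.left) :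
    extP T X Y E := by
  obtain ⟨Z, hZ, hXZ⟩ := hX.exists_zero
  obtain ⟨Z', hZ', hYZ'⟩ := hY.exists_zero
  let e : Z ⊞ T.obj E.left ≅ T.obj E.left :=
    { hom := biprod.snd
      inv := biprod.inr
      hom_inv_id := by
        ext
        · exact hZ.eq_of_src _ _
        · exact hZ.eq_of_src _ _
        · simp
        · simp }
  let e' : M ≅ M ⊞ T.obj Z' :=
    { hom := biprod.inl
      inv := biprod.fst
      hom_inv_id := by simp
      inv_hom_id := by
        ext
        · simp
        · simp
        · exact (T.map_isZero hZ').eq_of_src _ _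
        · exact (T.map_isZero hZ').eq_of_src _ _ }
  let f : (p T).obj (Z, E.left) ⟶ E :=
    { left := 𝟙 _
      right := e.hom ≫ str E
      w := by
        change T.map (𝟙 _) ≫ str E = biprod.inr ≫ biprod.snd ≫ str E
        simp }
  let g : E ⟶ (p T).obj (M, Z') :=
    { left := 0
      right := q ≫ e'.hom
      w := by
        change T.map 0 ≫ biprod.inr = str E ≫ q ≫ e'.hom
        rw [T.map_zero, zero_comp, reassoc_of% w, zero_comp] }
  have w'' : (e.hom ≫ str E) ≫ q = 0 := by rw [Category.assoc, w, comp_zero]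
  have w' : (e.hom ≫ str E) ≫ q ≫ e'.hom = 0 := by
    rw [Category.assoc, reassoc_of% w, zero_comp, comp_zero]
  have hfg : f ≫ g = 0 := by
    ext
    · exact hZ'.eq_of_tgt _ _
    · exact w'
  exact ⟨Z, M, E.left, Z', f, g, hfg, hXZ, hM, hE, hYZ',
    comma_shortExact hfg congr($(hfg).left) w' (shortExact_id_zero _ hZ')
      (shortExact_of_iso_right (shortExact_of_iso_left h e w'') e' w')⟩

lemma extP_p {X : ObjectProperty A} {Y : ObjectProperty B} (hX : X.ContainsZero)
    (hY : Y.ContainsZero) {M : A} {N : B} (hM : X M) (hN : Y N) :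
    extP T X Y ((p T).obj (M, N)) :=
  extP_of_shortExact hX hY (E := (p T).obj (M, N)) (biprod.fst : M ⊞ T.obj N ⟶ M) biprod.inr_fst
    (shortExact_biprod' M (T.obj N)) hM hN

lemma rightPerp_extP [EnoughProjectives A] [EnoughProjectives B] {X : ObjectProperty A}
    {Y : ObjectProperty B} {K : CommaCat T} (hX : rightPerp X K.right) (hY : rightPerp Y K.left) :
    rightPerp (extP T X Y) K := by
  rintro E ⟨M', M, N', N, f, g, w, hM', hM, hN', hN, h⟩
  exact Ext1Vanishes.middle_left h (ext1Vanishes_p (hX hM') (hY hN'))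
    (ext1Vanishes_p (hX hM) (hY hN))

lemma rightPerp_right_of_extP [EnoughProjectives A] {X : ObjectProperty A}
    {Y : ObjectProperty B} (hX : X.ContainsZero) (hY : Y.ContainsZero) {K : CommaCat T}
    (h : rightPerp (extP T X Y) K) : rightPerp X K.right := by
  obtain ⟨Z, hZ, hYZ⟩ := hY.exists_zero
  intro M hM
  exact Ext1Vanishes.right_of_p hZ (h (extP_p hX hY hM hYZ))

lemma rightPerp_left_of_extP [EnoughProjectives B] {X : ObjectProperty A}
    {Y : ObjectProperty B} (hX : X.ContainsZero) (hY : Y.ContainsZero) (hT : IsExactOn T Y)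
    {K : CommaCat T} (h : rightPerp (extP T X Y) K) : rightPerp Y K.left := by
  obtain ⟨Z, hZ, hXZ⟩ := hX.exists_zero
  intro N hN
  exact Ext1Vanishes.left_of_p hZ (fun S hS e => hT S hS (e ▸ hN)) (h (extP_p hX hY hXZ hN))

/-- The structure morphisms of the terms of a short complex `S` in the comma category. -/
def strHom (S : ShortComplex (CommaCat T)) :
    (ShortComplex.mk S.f.left S.g.left congr($(S.zero).left)).map T ⟶
      ShortComplex.mk S.f.right S.g.right congr($(S.zero).right) where
  τ₁ := str S.X₁
  τ₂ := str S.X₂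
  τ₃ := str S.X₃
  comm₁₂ := (str_comm S.f).symm
  comm₂₃ := (str_comm S.g).symm

/-- In a short exact sequence of the comma category whose last structure morphism is a
monomorphism, the cokernels of the structure morphisms form a short exact sequence. -/
lemma shortExact_cokernel_str {S : ShortComplex (CommaCat T)} (hS : S.ShortExact)
    (h : Mono (str S.X₃)) :
    ∃ (f : cokernel (str S.X₁) ⟶ cokernel (str S.X₂))
      (g : cokernel (str S.X₂) ⟶ cokernel (str S.X₃)) (w : f ≫ g = 0),
        cokernel.π (str S.X₁) ≫ f = S.f.right ≫ cokernel.π (str S.X₂) ∧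
        (ShortComplex.mk f g w).ShortExact := by
  have : Mono (strHom S).τ₃ := h
  have hl := shortExact_left hS
  have := hl.epi_g
  have : Epi ((ShortComplex.mk S.f.left S.g.left congr($(S.zero).left)).map T).g :=
    inferInstanceAs (Epi (T.map _))
  exact ⟨_, _, _, cokernel.π_desc _ _ _, shortExact_cokernels (strHom S)
    (exact_map_of_shortExact hl) (shortExact_right hS)⟩

lemma mono_str_p (M : A) (N : B) : Mono (str ((p T).obj (M, N))) :=
  inferInstanceAs (Mono (biprod.inr : T.obj N ⟶ M ⊞ T.obj N))

/-- The cokernel of the structure morphism of `𝐩(M, N)` is `M`. -/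
noncomputable def cokernelStrP (M : A) (N : B) : cokernel (str ((p T).obj (M, N))) ≅ M :=
  cokernelBiprodInrIso (X := M) (Y := T.obj N)

lemma mono_str_of_extP {X : ObjectProperty A} {Y : ObjectProperty B} (hT : IsExactOn T Y)
    {E : CommaCat T} (hE : extP T X Y E) : Mono (str E) := by
  obtain ⟨M', M, N', N, f, g, w, hM', hM, hN', hN, h⟩ := hE
  have hTS := hT _ (shortExact_left h) hN
  have := hTS.mono_f
  have := (shortExact_right h).mono_f
  have : Mono (strHom (ShortComplex.mk f g w)).τ₁ := mono_str_p M' N'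
  have : Mono (strHom (ShortComplex.mk f g w)).τ₃ := mono_str_p M N
  exact ShortComplex.mono_τ₂_of_exact_of_mono (strHom (ShortComplex.mk f g w)) hTS.exact

lemma cokernel_str_of_extP {X : ObjectProperty A} {Y : ObjectProperty B} (hX : X.ContainsZero)
    (hX' : X.IsClosedUnderExtensions) {E : CommaCat T} (hE : extP T X Y E) :
    X (cokernel (str E)) := by
  obtain ⟨M', M, N', N, f, g, w, hM', hM, hN', hN, h⟩ := hE
  obtain ⟨_, _, _, -, h'⟩ := shortExact_cokernel_str h (mono_str_p M N)
  exact hX'.prop_X₂_of_shortExact h'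
    (prop_of_iso_of_closedUnderExtensions hX hX' (cokernelStrP M' N') hM')
    (prop_of_iso_of_closedUnderExtensions hX hX' (cokernelStrP M N) hM)

lemma left_of_extP {X : ObjectProperty A} {Y : ObjectProperty B}
    (hY : Y.IsClosedUnderExtensions) {E : CommaCat T} (hE : extP T X Y E) : Y E.left := by
  obtain ⟨M', M, N', N, f, g, w, hM', hM, hN', hN, h⟩ := hE
  exact hY.prop_X₂_of_shortExact (shortExact_left h) hN' hN

lemma rightPerp_of_iso {C : Type u} [Category.{v} C] [Abelian C] {X : ObjectProperty C} {M N : C}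
    (h : rightPerp X M) (e : N ≅ M) : rightPerp X N :=
  fun _ hG => Ext1Vanishes.of_retract_right (h hG) ⟨e.hom, e.inv, e.hom_inv_id⟩

/-- Given an object `E` of the comma category, let `N ⟶ E.left` be a special `𝒴`-precover, embed
`T(N)` into `E.right ⊞ I` with `I` injective, and pull the resulting extension back along a special
`𝒳`-precover of the cokernel: this is a special `⟨𝐩(𝒳, 𝒴)⟩`-precover of `E`. -/
theorem isSpecialPrecovering_extP [EnoughProjectives A] [EnoughInjectives A] [EnoughProjectives B]
    {X : ObjectProperty A} {Y : ObjectProperty B} (hX : X.ContainsZero) (hY : Y.ContainsZero)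
    (hXp : IsSpecialPrecovering X) (hYp : IsSpecialPrecovering Y) :
    IsSpecialPrecovering (extP T X Y) := by
  intro E
  obtain ⟨N, g, hg⟩ := hYp E.left
  have := hg.epi
  let I := Injective.under (T.obj N)
  let j : T.obj N ⟶ E.right ⊞ I := biprod.lift (T.map g ≫ str E) (Injective.ι _)
  have hj : j ≫ biprod.snd = Injective.ι _ := biprod.lift_snd _ _
  have : Mono j := mono_of_mono_fac hj
  obtain ⟨G, f, hf⟩ := hXp (cokernel j)
  have := hf.epi
  obtain ⟨P, k, q, hpb⟩ : ∃ (P : A) (k : P ⟶ E.right ⊞ I) (q : P ⟶ G),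
      IsPullback k q (cokernel.π j) f := ⟨_, _, _, IsPullback.of_hasPullback _ _⟩
  obtain ⟨i, w, hi, hik⟩ := shortExact_of_isPullback (shortExact_cokernel j) hpb
  obtain ⟨i', w', hi', -⟩ := shortExact_of_isPullback (shortExact_kernel f) hpb.flip
  dsimp at i w hi hik i' w' hi'
  have hk : Epi k := hi'.epi_g
  let h : ({ left := N, right := P, hom := i } : CommaCat T) ⟶ E :=
    { left := g
      right := k ≫ biprod.fst
      w := by
        change T.map g ≫ str E = i ≫ k ≫ biprod.fst
        rw [reassoc_of% hik]
        simp [j] }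
  have : Epi h.left := hg.epi
  have : Epi h.right := inferInstanceAs (Epi (k ≫ biprod.fst))
  have : Epi h := epi_of_components T h
  have hker := shortExact_kernel h
  refine ⟨_, h, ⟨inferInstance, ?_, ?_⟩⟩
  · exact extP_of_shortExact hX hY (E := { left := N, right := P, hom := i }) _ w hi hf.mem hg.mem
  · apply rightPerp_extP
    · refine rightPerp_of_iso (M := kernel (k ≫ (biprod.fst : E.right ⊞ I ⟶ E.right))) ?_
        (kernelIsoOfShortExact (shortExact_right hker)).symm
      intro M hM
      refine Ext1Vanishes.middle_right (shortExact_kernel_comp k biprod.fst) ?_ ?_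
      · exact rightPerp_of_iso hf.kernel_mem (kernelIsoOfShortExact hi') hM
      · exact (Ext1Vanishes.of_injective M I inferInstance).of_retract_right
          (Retract.ofIso (kernelIsoOfShortExact (shortExact_biprod' E.right I)))
    · exact rightPerp_of_iso hg.kernel_mem (kernelIsoOfShortExact (shortExact_left hker)).symm

/-- The morphism in `ℬ` underlying a special `⟨𝐩(𝒳, 𝒴)⟩`-precover of `(0, N)` is a special
`𝒴`-precover of `N`. -/
theorem isSpecialPrecovering_left_of_extP [EnoughProjectives B]
    {X : ObjectProperty A} {Y : ObjectProperty B} (hX : X.ContainsZero) (hY : Y.ContainsZero)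
    (hT : IsExactOn T Y) (hY' : Y.IsClosedUnderExtensions)
    (h : IsSpecialPrecovering (extP T X Y)) : IsSpecialPrecovering Y := by
  intro N
  obtain ⟨E, f, hf⟩ := h { left := N, right := 0, hom := 0 }
  have := hf.epi
  have hker := shortExact_kernel f
  exact ⟨E.left, f.left, inferInstance, left_of_extP hY' hf.mem,
    rightPerp_of_iso (rightPerp_left_of_extP hX hY hT hf.kernel_mem)
      (kernelIsoOfShortExact (shortExact_left hker))⟩

/-- For a special `⟨𝐩(𝒳, 𝒴)⟩`-precover `E ⟶ (M, 0)` the sequence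
`0 ⟶ T(E.left) ⟶ E.right ⟶ G ⟶ 0` splits, and `G ⟶ M` is a special `𝒳`-precover, its kernel being
a direct summand of the kernel of `E.right ⟶ M`. -/
theorem isSpecialPrecovering_right_of_extP [EnoughProjectives A] [EnoughProjectives B]
    {X : ObjectProperty A} {Y : ObjectProperty B} (hX : X.ContainsZero) (hY : Y.ContainsZero)
    (hT : IsExactOn T Y) (hXY : ∀ N : B, Y N → rightPerp Y N → rightPerp X (T.obj N))
    (hX' : X.IsClosedUnderExtensions) (hY' : Y.IsClosedUnderExtensions)
    (h : IsSpecialPrecovering (extP T X Y)) : IsSpecialPrecovering X := by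
  intro M
  obtain ⟨E, f, hf⟩ := h (ofRight T M)
  have := hf.epi
  have hker := shortExact_kernel f
  have hmono := mono_str_of_extP hT hf.mem
  have hcok := cokernel_str_of_extP hX hX' hf.mem
  have hιmono : Mono (kernel.ι f).left := inferInstance
  have hιiso : IsIso (kernel.ι f).left :=
    ((shortExact_left hker).isIso_f_iff).2 (isZero_zero B)
  have hperp : rightPerp X (T.obj E.left) :=
    hXY _ (left_of_extP hY' hf.mem)
      (rightPerp_of_iso (rightPerp_left_of_extP hX hY hT hf.kernel_mem)
        (asIso (kernel.ι f).left).symm)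
  obtain ⟨s, hs⟩ := Ext1Vanishes.exists_lift (shortExact_cokernel (str E)) (hperp hcok) (𝟙 _)
  dsimp at s hs
  let a : E.right ⟶ M := f.right
  have hw : str E ≫ a = 0 := (str_comm f).symm.trans comp_zero
  have ha : Epi a := inferInstanceAs (Epi f.right)
  let b : cokernel (str E) ⟶ M := cokernel.desc _ a hw
  have hb : cokernel.π (str E) ≫ b = a := cokernel.π_desc _ _ _
  refine ⟨cokernel (str E), b, epi_of_epi_fac hb, hcok, fun G hG => ?_⟩
  have hK : Ext1Vanishes G (kernel a) :=
    rightPerp_of_iso (rightPerp_right_of_extP hX hY hf.kernel_mem)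
      (kernelIsoOfShortExact (shortExact_right hker)) hG
  refine hK.of_retract_right
    { i := kernel.lift _ (kernel.ι b ≫ s) ?_
      r := kernel.lift _ (kernel.ι a ≫ cokernel.π (str E)) ?_
      retract := ?_ }
  · rw [← hb, Category.assoc, reassoc_of% hs, kernel.condition]
  · rw [Category.assoc, hb, kernel.condition]
  · ext
    simp [hs]

end SpecialPrecover

/-! ### Gorenstein projective objects -/

section Gorenstein

variable {C : Type u} [Category.{v} C] [Abelian C]

/-- `M` is a syzygy of `M'`: there is a short exact sequence `0 ⟶ M ⟶ P ⟶ M' ⟶ 0` with `P`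
projective. -/
def IsSyzygy (M M' : C) : Prop :=
  ∃ (P : C) (i : M ⟶ P) (q : P ⟶ M') (w : i ≫ q = 0),
    Projective P ∧ (ShortComplex.mk i q w).ShortExact

lemma acyclic_iff (K : CochainComplex C ℤ) :
    K.Acyclic ↔ ∀ n : ℤ, (K.sc' n (n + 1) (n + 1 + 1)).Exact := by
  constructor
  · intro h n
    exact (K.exactAt_iff' n (n + 1) (n + 1 + 1) (by simp) (by simp)).1 (h _)
  · intro h n
    obtain ⟨m, rfl⟩ : ∃ m, n = m + 1 := ⟨n - 1, by simp⟩
    exact (K.exactAt_iff' m (m + 1) (m + 1 + 1) (by simp) (by simp)).2 (h _)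

lemma homComplex_acyclic_iff (K : CochainComplex C ℤ) (N : C) :
    (homComplex K N).Acyclic ↔ ∀ (n : ℤ) (f : K.X (n + 1) ⟶ N), K.d n (n + 1) ≫ f = 0 →
      ∃ g : K.X (n + 1 + 1) ⟶ N, K.d (n + 1) (n + 1 + 1) ≫ g = f := by
  have key : ∀ n : ℤ, (homComplex K N).ExactAt (n + 1) ↔
      ∀ (f : K.X (n + 1) ⟶ N), K.d n (n + 1) ≫ f = 0 →
        ∃ g : K.X (n + 1 + 1) ⟶ N, K.d (n + 1) (n + 1 + 1) ≫ g = f := by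
    intro n
    rw [(homComplex K N).exactAt_iff' (n + 1 + 1) (n + 1) n
      (ComplexShape.prev_eq' _ (by simp)) (ComplexShape.next_eq' _ (by simp)),
      ShortComplex.ab_exact_iff]
    rfl
  constructor
  · intro h n
    exact (key n).1 (h _)
  · intro h n
    obtain ⟨m, rfl⟩ : ∃ m, n = m + 1 := ⟨n - 1, by simp⟩
    exact (key m).2 (h m)

section Cycles

variable {K : CochainComplex C ℤ} (hK : K.Acyclic) (n : ℤ)

/-- The corestriction `Kⁿ ⟶ Zⁿ⁺¹(K)` of the differential. -/
noncomputable def toKernel (K : CochainComplex C ℤ) (n : ℤ) :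
    K.X n ⟶ kernel (K.d (n + 1) (n + 1 + 1)) :=
  kernel.lift _ (K.d n (n + 1)) (K.d_comp_d _ _ _)

lemma toKernel_ι (K : CochainComplex C ℤ) (n : ℤ) : toKernel K n ≫ kernel.ι _ = K.d n (n + 1) :=
  kernel.lift_ι _ _ _

include hK

lemma epi_toKernel : Epi (toKernel K n) :=
  ((K.sc' n (n + 1) (n + 1 + 1)).exact_iff_epi_kernel_lift).1 ((acyclic_iff K).1 hK n)

lemma shortExact_toKernel (w : kernel.ι (K.d n (n + 1)) ≫ toKernel K n = 0) :
    (ShortComplex.mk (kernel.ι (K.d n (n + 1))) (toKernel K n) w).ShortExact := by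
  have := epi_toKernel hK n
  refine .mk' (ShortComplex.exact_of_f_is_kernel _ ?_) inferInstance inferInstance
  refine KernelFork.IsLimit.ofι' _ _ fun {T} t ht => ?_
  have h0 : t ≫ K.d n (n + 1) = 0 := by
    have h1 : t ≫ toKernel K n = 0 := ht
    have h2 := congr($h1 ≫ kernel.ι _)
    rwa [Category.assoc, toKernel_ι, zero_comp] at h2
  exact ⟨kernel.lift _ _ h0, kernel.lift_ι _ _ _⟩

omit hK in
lemma ι_toKernel (K : CochainComplex C ℤ) (n : ℤ) :
    kernel.ι (K.d n (n + 1)) ≫ toKernel K n = 0 := by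
  rw [← cancel_mono (kernel.ι _), Category.assoc, toKernel_ι, kernel.condition, zero_comp]

end Cycles

lemma d_toKernel (K : CochainComplex C ℤ) (n : ℤ) :
    K.d n (n + 1) ≫ toKernel K (n + 1) = 0 := by
  rw [← cancel_mono (kernel.ι _), Category.assoc, toKernel_ι, K.d_comp_d, zero_comp]

/-- The cycles of an exact complex `K` of projective objects are left orthogonal to every `N` for
which `Hom(K, N)` is exact. -/
lemma IsExactProjectiveComplex.ext1Vanishes {K : CochainComplex C ℤ}
    (hK : IsExactProjectiveComplex K) {N : C} (h : (homComplex K N).Acyclic) (n : ℤ) :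
    Ext1Vanishes (kernel (K.d n (n + 1))) N := by
  obtain ⟨m, rfl⟩ : ∃ m, n = m + 1 + 1 + 1 := ⟨n - 1 - 1 - 1, by simp⟩
  have hS := shortExact_toKernel hK.exact (m + 1 + 1) (ι_toKernel K _)
  refine Ext1Vanishes.of_exists_extension hS (hK.projective _) fun f => ?_
  have := epi_toKernel hK.exact (m + 1)
  obtain ⟨g, hg⟩ := (homComplex_acyclic_iff K N).1 h m (toKernel K (m + 1) ≫ f)
    ((Category.assoc _ _ _).symm.trans (by rw [d_toKernel, zero_comp]))
  refine ⟨g, ?_⟩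
  rw [← cancel_epi (toKernel K (m + 1)), ← hg]
  exact (Category.assoc _ _ _).symm.trans congr($(toKernel_ι K (m + 1)) ≫ g)

lemma exists_int_sequence {α : Type*} (R : α → α → Prop) (h₁ : ∀ a, ∃ b, R a b)
    (h₂ : ∀ b, ∃ a, R a b) (a : α) : ∃ z : ℤ → α, z 0 = a ∧ ∀ n, R (z n) (z (n + 1)) := by
  choose next hnext using h₁
  choose prev hprev using h₂
  -- Iterate successors in nonnegative degrees and predecessors in negative degrees.
  refine ⟨fun n => match n with
    | .ofNat n => next^[n] a
    | .negSucc n => prev^[n + 1] a, rfl, fun n => ?_⟩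
  match n with
  | .ofNat n =>
    change R (next^[n] a) (next^[n + 1] a)
    rw [Function.iterate_succ_apply']
    exact hnext _
  | .negSucc 0 => exact hprev a
  | .negSucc (n + 1) =>
    change R (prev^[n + 1 + 1] a) (prev^[n + 1] a)
    rw [Function.iterate_succ_apply' _ (n + 1)]
    exact hprev _

/-- Splicing short exact sequences: a class of objects in which every object is a syzygy and has a
syzygy, and which is left orthogonal to the projective objects, consists of Gorenstein projective
objects. -/
theorem gorensteinProjective_of_class (W : ObjectProperty C)
    (h₁ : ∀ M, W M → ∃ M', W M' ∧ IsSyzygy M M') (h₂ : ∀ M', W M' → ∃ M, W M ∧ IsSyzygy M M')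
    (h₃ : ∀ M P, W M → Projective P → Ext1Vanishes M P) {M : C} (hM : W M) :
    gorensteinProjective C M := by
  obtain ⟨z, hz₀, hz⟩ := exists_int_sequence (α := { M : C // W M })
    (fun M M' => IsSyzygy M.1 M'.1)
    (fun M => by obtain ⟨M', h, h'⟩ := h₁ M.1 M.2; exact ⟨⟨M', h⟩, h'⟩)
    (fun M => by obtain ⟨M', h, h'⟩ := h₂ M.1 M.2; exact ⟨⟨M', h⟩, h'⟩) ⟨M, hM⟩
  choose P i q w hP hS using hz
  have hi : ∀ n, Mono (i n) := fun n => (hS n).mono_f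
  have hq : ∀ n, Epi (q n) := fun n => (hS n).epi_g
  let K : CochainComplex C ℤ := CochainComplex.of P (fun n => q n ≫ i (n + 1)) fun n => by
    rw [Category.assoc, reassoc_of% (w (n + 1)), zero_comp, comp_zero]
  have hd : ∀ n, K.d n (n + 1) = q n ≫ i (n + 1) := fun n =>
    CochainComplex.of_d P (fun n => q n ≫ i (n + 1)) n
  have hexact : K.Acyclic := by
    rw [acyclic_iff]
    intro n
    rw [ShortComplex.exact_iff_exact_up_to_refinements]
    intro T x hx
    have hx' : x ≫ q (n + 1) = 0 := by
      have h : x ≫ K.d (n + 1) (n + 1 + 1) = 0 := hx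
      rw [hd] at h
      rw [← cancel_mono (i (n + 1 + 1)), zero_comp, ← h]
      exact Category.assoc _ _ _
    obtain ⟨l, hl⟩ := KernelFork.IsLimit.lift' (hS (n + 1)).fIsKernel _ hx'
    obtain ⟨T', π, hπ, y, hy⟩ := surjective_up_to_refinements_of_epi (q n) l
    refine ⟨T', π, hπ, y, ?_⟩
    change π ≫ x = y ≫ K.d n (n + 1)
    rw [hd, ← hl]
    exact ((Category.assoc _ _ _).symm.trans congr($hy ≫ i (n + 1))).trans (Category.assoc _ _ _)
  refine ⟨K, ⟨⟨hexact, hP⟩, fun Q hQ => ?_⟩, ⟨?_⟩⟩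
  · rw [homComplex_acyclic_iff]
    intro n f hf
    have h0 : i (n + 1) ≫ f = 0 := by
      rw [hd] at hf
      rw [← cancel_epi (q n), comp_zero, ← hf]
      exact (Category.assoc _ _ _).symm
    obtain ⟨l, hl⟩ := CokernelCofork.IsColimit.desc' (hS (n + 1)).gIsCokernel _ h0
    obtain ⟨g, hg⟩ := Ext1Vanishes.exists_extension (hS (n + 1 + 1)) (h₃ _ Q (z _).2 hQ) l
    refine ⟨g, ?_⟩
    rw [hd]
    refine (Category.assoc _ _ _).trans ?_
    exact (congr(q (n + 1) ≫ $hg)).trans hl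
  · have hd0 : K.d 0 1 = q 0 ≫ i 1 := hd 0
    refine eqToIso congr($(hz₀).1).symm ≪≫
      (kernelIsoOfShortExact (hS 0)).symm ≪≫ (kernelCompMono (q 0) (i 1)).symm ≪≫
        kernelIsoOfEq hd0.symm

/-- The cycles of complete projective resolutions, in all degrees. -/
def completeCycles (C : Type u) [Category.{v} C] [Abelian C] : ObjectProperty C := fun M =>
  ∃ (K : CochainComplex C ℤ) (n : ℤ), IsCompleteProjectiveResolution K ∧
    Nonempty (M ≅ kernel (K.d n (n + 1)))

lemma exists_syzygy_of_completeCycles {M : C} (h : completeCycles C M) :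
    ∃ M', completeCycles C M' ∧ IsSyzygy M M' := by
  obtain ⟨K, n, hK, ⟨e⟩⟩ := h
  have hS := shortExact_toKernel hK.exact n (ι_toKernel K n)
  exact ⟨_, ⟨K, n + 1, hK, ⟨Iso.refl _⟩⟩, K.X n, e.hom ≫ kernel.ι _, toKernel K n,
    by rw [Category.assoc, ι_toKernel, comp_zero], hK.projective n, shortExact_of_iso_left hS e _⟩

lemma exists_syzygy_of_completeCycles' {M : C} (h : completeCycles C M) :
    ∃ M', completeCycles C M' ∧ IsSyzygy M' M := by
  obtain ⟨K, n, hK, ⟨e⟩⟩ := h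
  obtain ⟨n, rfl⟩ : ∃ m, n = m + 1 := ⟨n - 1, by simp⟩
  have hS := shortExact_toKernel hK.exact n (ι_toKernel K n)
  have w : kernel.ι (K.d n (n + 1)) ≫ toKernel K n ≫ e.symm.hom = 0 := by
    rw [← Category.assoc, ι_toKernel, zero_comp]
  exact ⟨_, ⟨K, n, hK, ⟨Iso.refl _⟩⟩, K.X n, kernel.ι _, toKernel K n ≫ e.symm.hom, w,
    hK.projective n, shortExact_of_iso_right hS e.symm _⟩

lemma ext1Vanishes_of_completeCycles {M P : C} (h : completeCycles C M) (hP : Projective P) :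
    Ext1Vanishes M P := by
  obtain ⟨K, n, hK, ⟨e⟩⟩ := h
  exact (hK.toIsExactProjectiveComplex.ext1Vanishes (hK.hom_exact P hP) n).of_iso_left e

/-- Choosing the degree `0` in the definition of Gorenstein projective objects is immaterial. -/
lemma gorensteinProjective_iff_completeCycles (M : C) :
    gorensteinProjective C M ↔ completeCycles C M :=
  ⟨fun ⟨K, hK, h⟩ => ⟨K, 0, hK, h⟩, gorensteinProjective_of_class _
    (fun _ => exists_syzygy_of_completeCycles) (fun _ => exists_syzygy_of_completeCycles')
    (fun _ _ => ext1Vanishes_of_completeCycles)⟩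

namespace gorensteinProjective

lemma exists_syzygy {M : C} (h : gorensteinProjective C M) :
    ∃ M', gorensteinProjective C M' ∧ IsSyzygy M M' := by
  simp only [gorensteinProjective_iff_completeCycles] at h ⊢
  exact exists_syzygy_of_completeCycles h

lemma exists_syzygy' {M : C} (h : gorensteinProjective C M) :
    ∃ M', gorensteinProjective C M' ∧ IsSyzygy M' M := by
  simp only [gorensteinProjective_iff_completeCycles] at h ⊢
  exact exists_syzygy_of_completeCycles' h

lemma ext1Vanishes {M P : C} (h : gorensteinProjective C M) (hP : Projective P) :
    Ext1Vanishes M P :=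
  ext1Vanishes_of_completeCycles ((gorensteinProjective_iff_completeCycles M).1 h) hP

lemma of_iso {M N : C} (h : gorensteinProjective C M) (e : N ≅ M) : gorensteinProjective C N := by
  obtain ⟨K, hK, ⟨e'⟩⟩ := h
  exact ⟨K, hK, ⟨e ≪≫ e'⟩⟩

lemma of_isZero {M : C} (hM : IsZero M) : gorensteinProjective C M := by
  refine gorensteinProjective_of_class IsZero (fun M hM => ?_) (fun M hM => ?_)
    (fun M P hM _ => Ext1Vanishes.of_projective M P hM.projective) hM
  all_goals
    refine ⟨M, hM, M, 𝟙 _, 0, comp_zero, hM.projective, shortExact_id_zero M hM⟩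

lemma containsZero : (gorensteinProjective C).ContainsZero :=
  ⟨_, isZero_zero C, of_isZero (isZero_zero C)⟩

/-- Gorenstein projective objects are closed under extensions. The projective presentations and
copresentations of the outer terms are combined by the horseshoe lemma. -/
lemma isClosedUnderExtensions : (gorensteinProjective C).IsClosedUnderExtensions where
  prop_X₂_of_shortExact {S} hS hS₁ hS₃ := by
    refine gorensteinProjective_of_class
      (fun M => ∃ S : ShortComplex C, S.ShortExact ∧ gorensteinProjective C S.X₁ ∧
        gorensteinProjective C S.X₃ ∧ S.X₂ = M) ?_ ?_ ?_ ⟨S, hS, hS₁, hS₃, rfl⟩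
    · rintro _ ⟨S, hS, hS₁, hS₃, rfl⟩
      obtain ⟨M', hM', P, i, q, w, hP, h⟩ := hS₁.exists_syzygy
      obtain ⟨N', hN', Q, j, r, w', hQ, h'⟩ := hS₃.exists_syzygy
      obtain ⟨k, hk⟩ := Ext1Vanishes.exists_extension hS (hS₃.ext1Vanishes hP) i
      let φ : S ⟶ ShortComplex.mk (biprod.inl : P ⟶ P ⊞ Q) biprod.snd (by simp) :=
        { τ₁ := i
          τ₂ := biprod.lift k (S.g ≫ j)
          τ₃ := j
          comm₁₂ := by ext <;> simp [hk]
          comm₂₃ := by simp }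
      have hφ₁ : Mono φ.τ₁ := h.mono_f
      have hφ₃ : Mono φ.τ₃ := h'.mono_f
      have := hS.mono_f
      have := hS.epi_g
      have : Mono (ShortComplex.mk (biprod.inl : P ⟶ P ⊞ Q) biprod.snd (by simp)).f :=
        inferInstanceAs (Mono (biprod.inl : P ⟶ P ⊞ Q))
      have hφ₂ : Mono φ.τ₂ := ShortComplex.mono_τ₂_of_exact_of_mono φ hS.exact
      have hc := shortExact_cokernels φ hS.exact (shortExact_biprod P Q)
      refine ⟨cokernel φ.τ₂, ⟨_, hc, ?_, ?_, rfl⟩, P ⊞ Q, φ.τ₂, cokernel.π _,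
        cokernel.condition _, inferInstance, shortExact_cokernel _⟩
      · exact hM'.of_iso ((cokernelIsCokernel i).coconePointUniqueUpToIso h.gIsCokernel)
      · exact hN'.of_iso ((cokernelIsCokernel j).coconePointUniqueUpToIso h'.gIsCokernel)
    · rintro _ ⟨S, hS, hS₁, hS₃, rfl⟩
      obtain ⟨M', hM', P, i, q, w, hP, h⟩ := hS₁.exists_syzygy'
      obtain ⟨N', hN', Q, j, r, w', hQ, h'⟩ := hS₃.exists_syzygy'
      have := hS.mono_f
      have := hS.epi_g
      let φ : ShortComplex.mk (biprod.inl : P ⟶ P ⊞ Q) biprod.snd (by simp) ⟶ S :=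
        { τ₁ := q
          τ₂ := biprod.desc (q ≫ S.f) (Projective.factorThru r S.g)
          τ₃ := r
          comm₁₂ := by simp
          comm₂₃ := by ext <;> simp }
      have hφ₁ : Epi φ.τ₁ := h.epi_g
      have hφ₃ : Epi φ.τ₃ := h'.epi_g
      have : Epi (ShortComplex.mk (biprod.inl : P ⟶ P ⊞ Q) biprod.snd (by simp)).g :=
        inferInstanceAs (Epi (biprod.snd : P ⊞ Q ⟶ Q))
      have hφ₂ : Epi φ.τ₂ := ShortComplex.epi_τ₂_of_exact_of_epi φ hS.exact
      have hc := shortExact_kernels φ (shortExact_biprod P Q) hS.exact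
      refine ⟨kernel φ.τ₂, ⟨_, hc, ?_, ?_, rfl⟩, P ⊞ Q, kernel.ι _, φ.τ₂,
        kernel.condition _, inferInstance, shortExact_kernel _⟩
      · exact hM'.of_iso (kernelIsoOfShortExact h)
      · exact hN'.of_iso (kernelIsoOfShortExact h')
    · rintro _ P ⟨S, hS, hS₁, hS₃, rfl⟩ hP
      exact Ext1Vanishes.middle_left hS (hS₁.ext1Vanishes hP) (hS₃.ext1Vanishes hP)

end gorensteinProjective

end Gorenstein

/-! ### Gorenstein projective objects of the comma category -/

section CommaGorenstein

set_option linter.unusedSectionVars false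

variable {A : Type u₁} [Category.{v₁} A] [Abelian A]
variable {B : Type u₂} [Category.{v₂} B] [Abelian B]
variable {T : B ⥤ A} [T.Additive] [PreservesFiniteColimits T]

/-- Condition (C1) says that `T` keeps the inclusions of the cycles of exact complexes of projective
objects monomorphic. -/
lemma IsCompatible.mono_map (hT : IsCompatible T) {K : CochainComplex B ℤ}
    (hK : IsExactProjectiveComplex K) (n : ℤ) {N : B} (i : N ⟶ K.X n) [Mono i]
    (w : i ≫ K.d n (n + 1) = 0) (hi : (ShortComplex.mk i (K.d n (n + 1)) w).Exact) :
    Mono (T.map i) := by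
  obtain ⟨m, rfl⟩ : ∃ m, n = m + 1 + 1 := ⟨n - 1 - 1, by simp⟩
  have hTK : ((K.sc' m (m + 1) (m + 1 + 1)).map T).Exact :=
    (acyclic_iff _).1 (hT.exact_map K hK) m
  obtain ⟨π, hπ⟩ : ∃ π : K.X (m + 1) ⟶ N, π ≫ i = K.d (m + 1) (m + 1 + 1) :=
    ⟨hi.lift (K.d (m + 1) (m + 1 + 1)) (K.d_comp_d _ _ _), hi.lift_f _ _⟩
  have : Epi π := by
    rw [epi_iff_surjective_up_to_refinements]
    intro X x
    obtain ⟨X', p, hp, y, hy⟩ := ((acyclic_iff K).1 hK.exact (m + 1)).exact_up_to_refinements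
      (x ≫ i) ((Category.assoc _ _ _).trans (by
        change x ≫ i ≫ K.d (m + 1 + 1) (m + 1 + 1 + 1) = 0
        rw [w, comp_zero]))
    have hy' : p ≫ x ≫ i = y ≫ K.d (m + 1) (m + 1 + 1) := hy
    refine ⟨X', p, hp, y, ?_⟩
    rw [← cancel_mono i, Category.assoc, hy', ← hπ]
    exact (Category.assoc _ _ _).symm
  have hdπ : K.d m (m + 1) ≫ π = 0 := by
    rw [← cancel_mono i, Category.assoc, hπ, K.d_comp_d, zero_comp]
  refine Preadditive.mono_of_cancel_zero _ fun {X} t ht => ?_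
  obtain ⟨X₁, p₁, _, y, hy⟩ := surjective_up_to_refinements_of_epi (T.map π) t
  have hyd : y ≫ T.map (K.d (m + 1) (m + 1 + 1)) = 0 := by
    rw [← hπ, T.map_comp, ← reassoc_of% hy, ht, comp_zero]
  obtain ⟨X₂, p₂, _, z, hz⟩ : ∃ (X₂ : A) (p₂ : X₂ ⟶ X₁) (_ : Epi p₂) (z : X₂ ⟶ T.obj (K.X m)),
      p₂ ≫ y = z ≫ T.map (K.d m (m + 1)) := hTK.exact_up_to_refinements y hyd
  rw [← cancel_epi p₁, ← cancel_epi p₂, hy, comp_zero, comp_zero, reassoc_of% hz, ← T.map_comp,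
    hdπ, T.map_zero, comp_zero]

/-- A right exact functor which keeps one projective presentation of `N` short exact keeps every
short exact sequence ending in `N` short exact, by cobase change. -/
lemma shortExact_map_of_projective {L P N : B} {i : L ⟶ P} {q : P ⟶ N} {w : i ≫ q = 0}
    (h : (ShortComplex.mk i q w).ShortExact) (hP : Projective P) (hi : Mono (T.map i))
    {X Y : B} {f : X ⟶ Y} {g : Y ⟶ N} {w' : f ≫ g = 0} (h' : (ShortComplex.mk f g w').ShortExact) :
    ((ShortComplex.mk f g w').map T).ShortExact := by
  have : Epi g := h'.epi_g
  obtain ⟨b, hb⟩ : ∃ b : P ⟶ Y, b ≫ g = q := ⟨Projective.factorThru q g, by simp⟩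
  obtain ⟨a, ha⟩ := KernelFork.IsLimit.lift' h'.fIsKernel (i ≫ b)
    ((Category.assoc _ _ _).trans (by rw [← w, ← hb]))
  have hpo := (isPushout_of_shortExact h h' a b ha.symm hb).map T
  refine shortExact_map_of_mono h' ?_
  exact MorphismProperty.of_isPushout (P := MorphismProperty.monomorphisms A) hpo.flip hi

lemma IsCompatible.isExactOn (hT : IsCompatible T) : IsExactOn T (gorensteinProjective B) := by
  rintro ⟨f, g, w⟩ hS hN
  obtain ⟨K, n, hK, ⟨e⟩⟩ := (gorensteinProjective_iff_completeCycles _).1 hN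
  obtain ⟨n, rfl⟩ : ∃ m, n = m + 1 := ⟨n - 1, by simp⟩
  have w : kernel.ι (K.d n (n + 1)) ≫ toKernel K n ≫ e.symm.hom = 0 := by
    rw [← Category.assoc, ι_toKernel, zero_comp]
  have h := shortExact_of_iso_right (shortExact_toKernel hK.exact n (ι_toKernel K n)) e.symm w
  refine shortExact_map_of_projective h (hK.projective n) ?_ hS
  exact hT.mono_map hK.toIsExactProjectiveComplex n _ (kernel.condition _)
    (ShortComplex.exact_of_f_is_kernel _ (kernelIsKernel _))

lemma IsCompatible.ext1Vanishes (hT : IsCompatible T) {M : A} (hM : gorensteinProjective A M)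
    {Q : B} (hQ : Projective Q) : Ext1Vanishes M (T.obj Q) := by
  obtain ⟨K, hK, ⟨e⟩⟩ := hM
  exact (hK.toIsExactProjectiveComplex.ext1Vanishes (hT.hom_exact K hK Q hQ) 0).of_iso_left e

/-- An object which is both Gorenstein projective and right orthogonal to the Gorenstein projective
objects is projective. -/
lemma gorensteinProjective.projective {C : Type u} [Category.{v} C] [Abelian C] {M : C}
    (hM : gorensteinProjective C M) (hM' : rightPerp (gorensteinProjective C) M) :
    Projective M := by
  obtain ⟨N, hN, P, i, q, w, hP, h⟩ := hM.exists_syzygy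
  obtain ⟨r, hr⟩ := Ext1Vanishes.exists_extension h (hM' hN) (𝟙 M)
  exact Retract.projective ⟨i, r, hr⟩

variable [EnoughProjectives A] [EnoughProjectives B]

/-- The structure morphism of a Gorenstein projective object is a monomorphism. -/
lemma gorensteinProjective.mono_str (hT : IsCompatible T) {E : CommaCat T}
    (hE : gorensteinProjective (CommaCat T) E) : Mono (str E) := by
  obtain ⟨K, hK, ⟨e⟩⟩ := hE
  let L := ((Comma.fst T (𝟭 A)).mapHomologicalComplex (ComplexShape.up ℤ)).obj K
  have hL : IsExactProjectiveComplex L :=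
    { exact := (acyclic_iff _).2 fun n =>
        ((acyclic_iff K).1 hK.exact n).map (Comma.fst T (𝟭 A))
      projective := fun n => projective_left (hK.projective n) }
  have hex : (ShortComplex.mk (kernel.ι (K.d 0 1)) (K.d 0 1) (kernel.condition _)).Exact :=
    ShortComplex.exact_of_f_is_kernel _ (kernelIsKernel _)
  let i : (kernel (K.d 0 1)).left ⟶ L.X 0 := (kernel.ι (K.d 0 1)).left
  have : Mono i := inferInstanceAs (Mono (kernel.ι (K.d 0 1)).left)
  have h₁ : Mono (T.map (kernel.ι (K.d 0 1)).left) :=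
    hT.mono_map hL 0 i congr($(kernel.condition (K.d 0 1)).left) (hex.map (Comma.fst T (𝟭 A)))
  have h₂ := mono_str_of_projective (hK.projective 0)
  have h₃ := str_comm (kernel.ι (K.d 0 1))
  have h₄ : IsIso e.hom.left := inferInstanceAs (IsIso ((Comma.fst T (𝟭 A)).map e.hom))
  have h₅ := str_comm e.hom
  have h₆ : Mono (str (kernel (K.d 0 1)) ≫ (kernel.ι (K.d 0 1)).right) := by
    rw [← h₃]
    exact mono_comp' h₁ h₂
  have h₇ : Mono (str (kernel (K.d 0 1))) := mono_of_mono _ (kernel.ι (K.d 0 1)).right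
  have h₈ : Mono (str E ≫ e.hom.right) := by
    rw [← h₅]
    infer_instance
  exact mono_of_mono _ e.hom.right

lemma IsSyzygy.cokernel_str {E E' : CommaCat T} (h : IsSyzygy E E') (hE' : Mono (str E')) :
    IsSyzygy (cokernel (str E)) (cokernel (str E')) := by
  obtain ⟨P, i, q, w, hP, h⟩ := h
  obtain ⟨f, g, w', -, h'⟩ := shortExact_cokernel_str h hE'
  exact ⟨_, f, g, w', projective_cokernel_str hP, h'⟩

lemma IsSyzygy.left {E E' : CommaCat T} (h : IsSyzygy E E') : IsSyzygy E.left E'.left := by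
  obtain ⟨P, i, q, w, hP, h⟩ := h
  exact ⟨_, _, _, _, projective_left hP, shortExact_left h⟩

/-- The cokernel of the structure morphism of a Gorenstein projective object is Gorenstein
projective. Maps from it to a projective object `P` are maps to the projective object `(P, 0)`. -/
lemma gorensteinProjective.cokernel_str (hT : IsCompatible T) {E : CommaCat T}
    (hE : gorensteinProjective (CommaCat T) E) : gorensteinProjective A (cokernel (str E)) := by
  refine gorensteinProjective_of_class
    (fun M => ∃ E : CommaCat T, gorensteinProjective _ E ∧ cokernel (str E) = M)
    ?_ ?_ ?_ ⟨E, hE, rfl⟩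
  · rintro _ ⟨E, hE, rfl⟩
    obtain ⟨E', hE', h⟩ := hE.exists_syzygy
    exact ⟨_, ⟨E', hE', rfl⟩, h.cokernel_str (hE'.mono_str hT)⟩
  · rintro _ ⟨E, hE, rfl⟩
    obtain ⟨E', hE', h⟩ := hE.exists_syzygy'
    exact ⟨_, ⟨E', hE', rfl⟩, h.cokernel_str (hE.mono_str hT)⟩
  · rintro _ P ⟨E, hE, rfl⟩ hP
    obtain ⟨E', hE', X, i, q, w, hX, h⟩ := hE.exists_syzygy'
    obtain ⟨f, g, w', hf, h'⟩ := shortExact_cokernel_str h (hE.mono_str hT)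
    refine Ext1Vanishes.of_exists_extension h' (projective_cokernel_str hX) fun a => ?_
    have ha : str E' ≫ cokernel.π (str E') ≫ a = 0 := by
      rw [← Category.assoc, cokernel.condition, zero_comp]
    obtain ⟨b, hb⟩ := Ext1Vanishes.exists_extension h
      (hE.ext1Vanishes (projective_ofRight hP)) (toOfRight (cokernel.π (str E') ≫ a) ha)
    have hw : str X ≫ (b.right : X.right ⟶ P) = 0 := (str_comm b).symm.trans comp_zero
    refine ⟨cokernel.desc (str X) b.right hw, ?_⟩
    have hb' : i.right ≫ b.right = cokernel.π (str E') ≫ a := congr($(hb).right)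
    rw [← cancel_epi (cokernel.π (str E')), ← hb']
    refine ((Category.assoc _ _ _).symm.trans congr($hf ≫ _)).trans
      ((Category.assoc _ _ _).trans congr(i.right ≫ $(cokernel.π_desc (str X) b.right hw)))

/-- The object of `ℬ` underlying a Gorenstein projective object is Gorenstein projective. By
condition (C2) a map from it to a projective object `Q` lifts to a map to the projective
object `𝐩(0, Q)`. -/
lemma gorensteinProjective.left (hT : IsCompatible T) {E : CommaCat T}
    (hE : gorensteinProjective (CommaCat T) E) : gorensteinProjective B E.left := by
  refine gorensteinProjective_of_class
    (fun N => ∃ E : CommaCat T, gorensteinProjective _ E ∧ E.left = N) ?_ ?_ ?_ ⟨E, hE, rfl⟩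
  · rintro _ ⟨E, hE, rfl⟩
    obtain ⟨E', hE', h⟩ := hE.exists_syzygy
    exact ⟨_, ⟨E', hE', rfl⟩, h.left⟩
  · rintro _ ⟨E, hE, rfl⟩
    obtain ⟨E', hE', h⟩ := hE.exists_syzygy'
    exact ⟨_, ⟨E', hE', rfl⟩, h.left⟩
  · rintro _ Q ⟨E, hE, rfl⟩ hQ
    obtain ⟨E', hE', X, i, q, w, hX, h⟩ := hE.exists_syzygy'
    refine Ext1Vanishes.of_exists_extension (shortExact_left h) (projective_left hX) fun b => ?_
    have := hE'.mono_str hT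
    obtain ⟨a, ha⟩ := Ext1Vanishes.exists_extension (shortExact_cokernel (str E'))
      (hT.ext1Vanishes (hE'.cokernel_str hT) hQ) (T.map b)
    let c : E' ⟶ (p T).obj (0, Q) :=
      { left := b
        right := a ≫ biprod.inr
        w := (congr($ha ≫ biprod.inr)).symm.trans (Category.assoc _ _ _) }
    obtain ⟨d, hd⟩ := Ext1Vanishes.exists_extension h
      (hE.ext1Vanishes (projective_p (isZero_zero A).projective hQ)) c
    exact ⟨d.left, congr($(hd).left)⟩

lemma gorensteinProjective_p (hT : IsCompatible T) {M : A} {N : B}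
    (hM : gorensteinProjective A M) (hN : gorensteinProjective B N) :
    gorensteinProjective (CommaCat T) ((p T).obj (M, N)) := by
  refine gorensteinProjective_of_class
    (fun E => ∃ (M : A) (N : B), gorensteinProjective A M ∧ gorensteinProjective B N ∧
      (p T).obj (M, N) = E) ?_ ?_ ?_ ⟨M, N, hM, hN, rfl⟩
  · rintro _ ⟨M, N, hM, hN, rfl⟩
    obtain ⟨M', hM', P, i, q, w, hP, h⟩ := hM.exists_syzygy
    obtain ⟨N', hN', Q, j, r, w', hQ, h'⟩ := hN.exists_syzygy
    exact ⟨_, ⟨M', N', hM', hN', rfl⟩, _, _, _, _, projective_p hP hQ,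
      shortExact_p h h' (hT.isExactOn _ h' hN')⟩
  · rintro _ ⟨M, N, hM, hN, rfl⟩
    obtain ⟨M', hM', P, i, q, w, hP, h⟩ := hM.exists_syzygy'
    obtain ⟨N', hN', Q, j, r, w', hQ, h'⟩ := hN.exists_syzygy'
    exact ⟨_, ⟨M', N', hM', hN', rfl⟩, _, _, _, _, projective_p hP hQ,
      shortExact_p h h' (hT.isExactOn _ h' hN)⟩
  · rintro _ E ⟨M, N, hM, hN, rfl⟩ hE
    obtain ⟨P, Q, hP, hQ, ⟨r⟩⟩ := exists_retract_p E hE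
    exact (ext1Vanishes_p ((hM.ext1Vanishes hP).biprod (hT.ext1Vanishes hM hQ))
      (hN.ext1Vanishes hQ)).of_retract_right r

theorem extP_gorensteinProjective (hT : IsCompatible T) :
    extP T (gorensteinProjective A) (gorensteinProjective B) =
      gorensteinProjective (CommaCat T) := by
  ext E
  constructor
  · rintro ⟨M', M, N', N, f, g, w, hM', hM, hN', hN, h⟩
    exact gorensteinProjective.isClosedUnderExtensions.prop_X₂_of_shortExact h
      (gorensteinProjective_p hT hM' hN') (gorensteinProjective_p hT hM hN)
  · intro hE
    have := hE.mono_str hT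
    exact extP_of_shortExact gorensteinProjective.containsZero gorensteinProjective.containsZero
      _ _ (shortExact_cokernel (str E)) (hE.cokernel_str hT) (hE.left hT)

end CommaGorenstein

end CommaPrecover

theorem theorem1p1 {A : Type u₁} [Category.{v₁} A] [Abelian A]
    {B : Type u₂} [Category.{v₂} B] [Abelian B]
    [EnoughProjectives A] [EnoughInjectives A] [EnoughProjectives B] [EnoughInjectives B]
    (T : B ⥤ A) [T.Additive] [PreservesFiniteColimits T] :
    (∀ (X : ObjectProperty A) (Y : ObjectProperty B), X.ContainsZero → Y.ContainsZero →
      CommaPrecover.IsExactOn T Y →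
        (CommaPrecover.IsSpecialPrecovering X ∧ CommaPrecover.IsSpecialPrecovering Y →
          CommaPrecover.IsSpecialPrecovering (CommaPrecover.extP T X Y)) ∧
        ((∀ N : B, Y N → CommaPrecover.rightPerp Y N → CommaPrecover.rightPerp X (T.obj N)) →
          X.IsClosedUnderExtensions → Y.IsClosedUnderExtensions →
          CommaPrecover.IsSpecialPrecovering (CommaPrecover.extP T X Y) →
            CommaPrecover.IsSpecialPrecovering X ∧ CommaPrecover.IsSpecialPrecovering Y)) ∧
    (CommaPrecover.IsCompatible T →
      (CommaPrecover.IsSpecialPrecovering (CommaPrecover.gorensteinProjective A) ∧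
          CommaPrecover.IsSpecialPrecovering (CommaPrecover.gorensteinProjective B) ↔
        CommaPrecover.IsSpecialPrecovering
          (CommaPrecover.gorensteinProjective (CommaPrecover.CommaCat T)))) := by
  open CommaPrecover in
  have converse : ∀ (X : ObjectProperty A) (Y : ObjectProperty B), X.ContainsZero →
      Y.ContainsZero → IsExactOn T Y →
      (∀ N : B, Y N → rightPerp Y N → rightPerp X (T.obj N)) →
      X.IsClosedUnderExtensions → Y.IsClosedUnderExtensions →
      IsSpecialPrecovering (extP T X Y) → IsSpecialPrecovering X ∧ IsSpecialPrecovering Y :=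
    fun X Y hX hY hT hXY hX' hY' h =>
      ⟨isSpecialPrecovering_right_of_extP hX hY hT hXY hX' hY' h,
        isSpecialPrecovering_left_of_extP hX hY hT hY' h⟩
  refine ⟨fun X Y hX hY hT => ⟨fun h => CommaPrecover.isSpecialPrecovering_extP hX hY h.1 h.2,
    converse X Y hX hY hT⟩, fun hT => ?_⟩
  have hA := CommaPrecover.gorensteinProjective.containsZero (C := A)
  have hB := CommaPrecover.gorensteinProjective.containsZero (C := B)
  rw [← CommaPrecover.extP_gorensteinProjective hT]
  exact ⟨fun h => CommaPrecover.isSpecialPrecovering_extP hA hB h.1 h.2,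
    converse _ _ hA hB hT.isExactOn
      (fun N hN hN' _ hM => hT.ext1Vanishes hM (hN.projective hN'))
      CommaPrecover.gorensteinProjective.isClosedUnderExtensions
      CommaPrecover.gorensteinProjective.isClosedUnderExtensions⟩
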